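/- Let $T$ be a tree on $n$ vertices with adjacency matrix $A(T)$ whose characteristic polynomial $\phi(x)=\det(xI-A(T))$ is irreducible over $\mathbb{Q}$, and let $\Delta(T)=\prod_{i<j}(\alpha_i-\alpha_j)^2$ be the discriminant of $\phi$, where $\alpha_1,\dots,\alpha_n$ are the roots of $\phi$. If $n\ge 2$, then $2^{-n/2}\sqrt{\Delta(T)}$ is an integer. If $2^{-n/2}\sqrt{\Delta(T)}$ is an odd and square-free integer, then every signed tree with underlying graph $T$ is determined by its generalized spectrum. Here a signed graph $\Gamma=(G,\sigma)$ is a finite simple graph $G$ (the underlying graph) together with a map $\sigma$ from the edges of $G$ to $\{1,-1\}$; its adjacency matrix $A(\Gamma)$ has entry $\sigma(ij)$ if $ij$ is an edge and $0$ otherwise. Two signed graphs are isomorphic if there is an isomorphism of their underlying graphs that preserves the sign of every edge. Two signed graphs $\Gamma,\Gamma'$ are generalized cospectral if $\det(xI-A(\Gamma))=\det(xI-A(\Gamma'))$ and $\det(xI-(J-I-A(\Gamma)))=\det(xI-(J-I-A(\Gamma')))$, where $J$ is the all-one matrix. A signed graph $\Gamma$ is determined by its generalized spectrum if every signed graph that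 is generalized cospectral with $\Gamma$ is isomorphic to $\Gamma$. -/

import Mathlib

/-- A signed graph on the vertex set `V`: a simple graph (the underlying graph) together with
a sign `1` or `-1` for every edge. -/
structure SignedGraph (V : Type*) where
  /-- the underlying graph -/
  graph : SimpleGraph V
  /-- the signature -/
  sign : graph.edgeSet → ℤˣ

namespace SignedGraph

open Classical in
/-- The adjacency matrix of a signed graph: the `(i, j)` entry is the sign of the edge `ij` if
`i` and `j` are adjacent, and `0` otherwise. -/
noncomputable def adjMatrix {V : Type*} (Γ : SignedGraph V) : Matrix V V ℤ :=
  Matrix.of fun i j => if h : Γ.graph.Adj i j then ((Γ.sign ⟨s(i, j), h⟩ : ℤˣ) : ℤ) else 0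

/-- The matrix `J - I - A(Γ)`, where `J` is the all-one matrix; formally the adjacency matrix of
the complement of `Γ`. -/
noncomputable def complMatrix {V : Type*} [DecidableEq V] (Γ : SignedGraph V) : Matrix V V ℤ :=
  Matrix.of (fun _ _ => 1) - 1 - Γ.adjMatrix

/-- Two signed graphs are generalized cospectral if `A` and `J - I - A` have the same
characteristic polynomials for both. -/
def GeneralizedCospectral {V W : Type*} [Fintype V] [DecidableEq V] [Fintype W] [DecidableEq W]
    (Γ : SignedGraph V) (Γ' : SignedGraph W) : Prop :=
  Γ.adjMatrix.charpoly = Γ'.adjMatrix.charpoly ∧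
    Γ.complMatrix.charpoly = Γ'.complMatrix.charpoly

/-- Two signed graphs are isomorphic if there is an isomorphism of the underlying graphs that
preserves the sign of every edge. -/
def IsIsomorphic {V W : Type*} (Γ : SignedGraph V) (Γ' : SignedGraph W) : Prop :=
  ∃ f : Γ.graph ≃g Γ'.graph, ∀ e : Γ.graph.edgeSet, Γ'.sign (f.mapEdgeSet e) = Γ.sign e

/-- A (finite) signed graph `Γ` is determined by its generalized spectrum (DGS) if every finite
signed graph that is generalized cospectral with `Γ` is isomorphic to `Γ`. -/
def IsDGS.{u} {V : Type u} [Fintype V] [DecidableEq V] (Γ : SignedGraph V) : Prop :=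
  ∀ (W : Type u) [Fintype W] [DecidableEq W] (Γ' : SignedGraph W),
    Γ'.GeneralizedCospectral Γ → Γ'.IsIsomorphic Γ

end SignedGraph

/-- The discriminant `Δ(G)` of a graph: the discriminant of the characteristic polynomial of its
adjacency matrix. -/
noncomputable def SimpleGraph.spectralDiscr {V : Type*} [Fintype V] [DecidableEq V]
    (G : SimpleGraph V) [DecidableRel G.Adj] : ℤ :=
  (G.adjMatrix ℤ).charpoly.discr

/-!
Let `A` be the adjacency matrix of a tree `T` on `n ≥ 2` vertices with irreducible characteristic
polynomial `φ`. Since `T` is bipartite, `φ` is even or odd, and irreducibility leaves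
`φ = f(x ^ 2)`. A forest has at most one perfect matching, so `φ(0) = det A = (-1) ^ (n / 2)`, and the norm of
`φ'(λ) = 2 λ f'(λ ^ 2)` gives `disc φ = 2 ^ n (disc f) ^ 2` (`PowerBasis.discr_expand_two`). Hence
`2 ^ (-n / 2) √Δ(T) = |disc f|`. Signed trees with underlying tree `T` have the same characteristic
polynomial, because every signature on a tree is a switching of the trivial one.

Let `B` be the adjacency matrix of a signed graph that is generalized cospectral with such a signed
tree, whose matrix is again called `A`. The generalized spectrum determines the numbers `eᵀ A ^ k e`
(`Matrix.sum_pow_eq`), and as `e` is a cyclic vector, the isometry `p(B) e ↦ p(A) e` is a rational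
orthogonal matrix `Q` with `A Q = Q B` and `Q e = e` (`Matrix.exists_orthogonal_intertwiner`). It
remains to see that `Q` is integral, for then it is a permutation matrix.

The commutant of `A` is the field `ℚ[A]`. This implies first that the second graph is connected,
hence a tree, as `A` and `B` have the same trace of the square; and then that `Q` respects the
bipartitions of the two trees (`Matrix.diagonal_mul_eq_or_eq_neg`). At a root `λ` of `φ` the matrix
`adj (λ I - A)` has rank one, whence
`(adj (λ I - A) Q)_ij ^ 2 = adj (λ I - A)_ii * adj (λ I - B)_jj`.
If `i` and `j` lie on opposite sides of the bipartitions, `Q_ij = 0`. Otherwise the three entries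
are odd polynomials in `λ`. After division by `λ ^ 2`, the right-hand side is an integral polynomial
in `β = λ ^ 2`, and the left-hand side is the square of an element `r(β)` of `ℚ(β)`, where `r` has
degree less than `n / 2` and the coefficient of `x ^ (n / 2 - 1)` in `r` is `Q_ij`. So `r(β)` is
integral over `ℤ`; as `disc f` is squarefree by hypothesis, `ℤ[β]` is integrally closed, and `Q_ij`
is an integer (`Matrix.exists_int_apply_of_intertwiner`).
-/

open Polynomial Matrix

/-! ### The adjugate of `x I - A` and the number of walks -/

section Adjugate

variable {V : Type*} [Fintype V] [DecidableEq V]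

/-- The entries of `adj (x I - M)` have degree less than the size of `M`: compare degrees in
`adj (x I - M) (x I - M) = φ I`, read as an identity of polynomials with matrix coefficients. -/
theorem Matrix.coeff_adjugate_charmatrix_of_card_le {R : Type*} [CommRing R] [Nontrivial R]
    (M : Matrix V V R) (i j : V) {k : ℕ} (hk : Fintype.card V ≤ k) :
    (M.charmatrix.adjugate i j).coeff k = 0 := by
  have hne : Nonempty V := ⟨i⟩
  have h1 : matPolyEquiv M.charmatrix.adjugate * (X - C M) =
      (M.charpoly).map (algebraMap R (Matrix V V R)) := by
    rw [← matPolyEquiv_charmatrix, ← map_mul, adjugate_mul, ← Matrix.charpoly,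
      matPolyEquiv_smul_one]
  have h2 := congrArg degree h1
  rw [(monic_X_sub_C M).degree_mul, degree_X_sub_C, (M.charpoly_monic).degree_map,
    charpoly_degree_eq_dim] at h2
  rw [← matPolyEquiv_coeff_apply, coeff_eq_zero_of_degree_lt]
  · rfl
  · by_contra! h
    have h3 : ((Fintype.card V : ℕ) : WithBot ℕ) + 1 ≤ (Fintype.card V : ℕ) :=
      (add_le_add (le_trans (by exact_mod_cast hk) h) le_rfl).trans_eq h2
    have h4 : Fintype.card V + 1 ≤ Fintype.card V := by exact_mod_cast h3
    omega

theorem Matrix.coeff_adjugate_charmatrix_card_sub_one {R : Type*} [CommRing R] [Nontrivial R]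
    (M : Matrix V V R) (i j : V) :
    (M.charmatrix.adjugate i j).coeff (Fintype.card V - 1) = (1 : Matrix V V R) i j := by
  have hne : Nonempty V := ⟨i⟩
  have hn : Fintype.card V = Fintype.card V - 1 + 1 := by
    have := Fintype.card_pos (α := V); omega
  have h := congrFun (congrFun (mul_adjugate M.charmatrix) i) j
  have h' := congrArg (fun p => p.coeff (Fintype.card V)) h
  simp only [charmatrix, Matrix.sub_mul, sub_apply, coeff_sub] at h'
  rw [← charmatrix, scalar_apply, diagonal_mul, mul_apply, finsetSum_coeff,
    Finset.sum_eq_zero (fun k _ => by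
      rw [RingHom.mapMatrix_apply, map_apply, coeff_C_mul,
        coeff_adjugate_charmatrix_of_card_le M _ _ le_rfl, mul_zero]), sub_zero] at h'
  conv_lhs at h' => rw [hn, coeff_X_mul]
  rw [h', ← Matrix.charpoly, smul_apply, smul_eq_mul]
  have hc := M.charpoly_monic.coeff_natDegree
  rw [charpoly_natDegree_eq_dim] at hc
  by_cases hij : i = j
  · subst hij
    rw [one_apply_eq, one_apply_eq, mul_one, hc]
  · rw [one_apply_ne hij, one_apply_ne hij, mul_zero, coeff_zero]

theorem Matrix.det_add_of_one {R : Type*} [CommRing R] [IsDomain R] (M : Matrix V V R)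
    (hM : M.det ≠ 0) :
    (M + Matrix.of fun _ _ => 1).det = M.det + ∑ i, ∑ j, M.adjugate i j := by
  let f := algebraMap R (FractionRing R)
  let u : V → FractionRing R := fun _ => 1
  apply IsFractionRing.injective R (FractionRing R)
  have hdet : (f.mapMatrix M).det ≠ 0 := by
    rw [← RingHom.map_det]
    exact fun h => hM (IsFractionRing.injective R (FractionRing R) (by rw [map_zero]; exact h))
  have hJ : f.mapMatrix (M + Matrix.of fun _ _ => 1) =
      f.mapMatrix M + replicateCol Unit u * replicateRow Unit u := by
    ext i j
    simp [mul_apply, u]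
  change f _ = f _
  rw [RingHom.map_det, hJ, det_add_replicateCol_mul_replicateRow (isUnit_iff_ne_zero.2 hdet),
    det_unique (n := Unit), add_apply, one_apply_eq, mul_add, mul_one, map_add, RingHom.map_det,
    inv_def]
  congr 1
  rw [Matrix.mul_smul, Matrix.smul_mul, smul_apply, smul_eq_mul, ← mul_assoc,
    Ring.mul_inverse_cancel _ (isUnit_iff_ne_zero.2 hdet), one_mul, ← RingHom.map_adjugate,
    map_sum]
  simp only [mul_apply, replicateRow_apply, replicateCol_apply, u, one_mul, mul_one,
    RingHom.mapMatrix_apply, map_apply, map_sum]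
  exact Finset.sum_comm

/-- The characteristic polynomial of `J - I - A` determines, together with that of `A`, the sum of
all entries of `adj (x I - A)`: substitute `x ↦ -x - 1` in the determinant of the rank-one
perturbation `x I - A + J`. -/
theorem Matrix.charpoly_of_one_sub_one_sub (A : Matrix V V ℤ) :
    (Matrix.of (fun _ _ => 1) - 1 - A).charpoly =
      (-1) ^ Fintype.card V * (A.charpoly + ∑ i, ∑ j, A.charmatrix.adjugate i j).comp (-X - 1) := by
  rw [Matrix.charpoly, Matrix.charpoly, ← Matrix.det_add_of_one _ A.charpoly_monic.ne_zero,
    ← coe_compRingHom_apply, RingHom.map_det, ← det_neg]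
  congr 1
  ext1 i j
  by_cases hij : i = j
  · subst hij
    simp
    ring
  · simp [hij]
    ring

theorem Matrix.sum_adjugate_charmatrix_eq {W : Type*} [Fintype W] [DecidableEq W]
    {A : Matrix V V ℤ} {B : Matrix W W ℤ} (h : A.charpoly = B.charpoly)
    (hc : (Matrix.of (fun _ _ => 1) - 1 - A).charpoly =
      (Matrix.of (fun _ _ => 1) - 1 - B).charpoly) :
    ∑ i, ∑ j, A.charmatrix.adjugate i j = ∑ i, ∑ j, B.charmatrix.adjugate i j := by
  have hcard : Fintype.card V = Fintype.card W := by
    rw [← charpoly_natDegree_eq_dim A, h, charpoly_natDegree_eq_dim]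
  rw [charpoly_of_one_sub_one_sub, charpoly_of_one_sub_one_sub, hcard, h] at hc
  have h1 := mul_left_cancel₀ (pow_ne_zero _ (by simp : (-1 : ℤ[X]) ≠ 0)) hc
  have h2 := congrArg (fun p => p.comp (-X - 1)) h1
  simp only [comp_assoc] at h2
  have h3 : (-X - 1 : ℤ[X]).comp (-X - 1) = X := by simp
  simpa [h3] using h2

end Adjugate

section Moments

variable {V W : Type*} [Fintype V] [DecidableEq V] [Fintype W] [DecidableEq W]

theorem Matrix.X_mul_sum_adjugate_charmatrix (A : Matrix V V ℤ) (B : Matrix V V ℤ) :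
    X * ∑ i, ∑ j, (A.charmatrix.adjugate * B.map C) i j =
      ∑ i, ∑ j, (A.charmatrix.adjugate * (A * B).map C) i j +
        A.charpoly * C (∑ i, ∑ j, B i j) := by
  have h : (X : ℤ[X]) • (A.charmatrix.adjugate * B.map C) =
      A.charmatrix.adjugate * (A * B).map C + A.charpoly • B.map C := by
    have h1 : A.charpoly • B.map C = A.charmatrix.adjugate * A.charmatrix * B.map C := by
      rw [adjugate_mul, Matrix.smul_mul, Matrix.one_mul, Matrix.charpoly]
    have h2 : A.map C + A.charmatrix = (X : ℤ[X]) • 1 := by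
      ext1 i j
      by_cases hij : i = j
      · subst hij
        simp
      · simp [hij]
    rw [h1, Matrix.map_mul, Matrix.mul_assoc A.charmatrix.adjugate A.charmatrix, ← Matrix.mul_add,
      ← Matrix.add_mul, h2, Matrix.smul_mul, Matrix.one_mul, Matrix.mul_smul]
  simp only [Finset.mul_sum, map_sum, ← Finset.sum_add_distrib]
  refine Finset.sum_congr rfl fun i _ => Finset.sum_congr rfl fun j _ => ?_
  have := congrFun (congrFun h i) j
  simpa using this

theorem Matrix.coeff_sum_adjugate_charmatrix_mul (A B : Matrix V V ℤ) :
    (∑ i, ∑ j, (A.charmatrix.adjugate * B.map C) i j).coeff (Fintype.card V - 1) =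
      ∑ i, ∑ j, B i j := by
  simp only [mul_apply, finsetSum_coeff, map_apply, coeff_mul_C,
    coeff_adjugate_charmatrix_card_sub_one]
  simp [one_apply]

/-- Equal characteristic polynomials and equal sums of the entries of `adj (x I - A)` force
the same number of (signed) walks of every length. The polynomials
`p_k = eᵀ adj (x I - A) A ^ k e` satisfy `x p_k = p_{k+1} + (eᵀ A ^ k e) φ`, where the `p_k` have
degree less than that of `φ`. -/
theorem Matrix.sum_pow_eq {A : Matrix V V ℤ} {B : Matrix W W ℤ} (h : A.charpoly = B.charpoly)
    (hs : ∑ i, ∑ j, A.charmatrix.adjugate i j = ∑ i, ∑ j, B.charmatrix.adjugate i j) (k : ℕ) :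
    ∑ i, ∑ j, (A ^ k) i j = ∑ i, ∑ j, (B ^ k) i j := by
  have hcard : Fintype.card V = Fintype.card W := by
    rw [← charpoly_natDegree_eq_dim A, h, charpoly_natDegree_eq_dim]
  have key : ∀ k, ∑ i, ∑ j, (A.charmatrix.adjugate * (A ^ k).map C) i j =
      ∑ i, ∑ j, (B.charmatrix.adjugate * (B ^ k).map C) i j := by
    intro k
    induction k with
    | zero => simpa using hs
    | succ k ih =>
      have hm : ∑ i, ∑ j, (A ^ k) i j = ∑ i, ∑ j, (B ^ k) i j := by
        rw [← coeff_sum_adjugate_charmatrix_mul A, ih, hcard, coeff_sum_adjugate_charmatrix_mul]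
      have hA := X_mul_sum_adjugate_charmatrix A (A ^ k)
      have hB := X_mul_sum_adjugate_charmatrix B (B ^ k)
      rw [ih, hB, hm, h, add_left_inj] at hA
      rw [pow_succ', pow_succ', hA]
  rw [← coeff_sum_adjugate_charmatrix_mul A, key, hcard, coeff_sum_adjugate_charmatrix_mul]

end Moments

/-! ### Matrices with irreducible characteristic polynomial -/

section Cyclic

variable {V : Type*} [Fintype V] [DecidableEq V] {K : Type*} [Field K]

theorem Matrix.aeval_mulVec_eq_zero_of_charpoly_dvd {M : Matrix V V K} {p : K[X]}
    (h : M.charpoly ∣ p) (v : V → K) : aeval M p *ᵥ v = 0 := by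
  obtain ⟨q, rfl⟩ := h
  rw [map_mul, aeval_self_charpoly, Matrix.zero_mul, zero_mulVec]

theorem Matrix.charpoly_dvd_of_aeval_mulVec_eq_zero {M : Matrix V V K}
    (hM : Irreducible M.charpoly) {v : V → K} (hv : v ≠ 0) {p : K[X]}
    (h : aeval M p *ᵥ v = 0) : M.charpoly ∣ p := by
  by_contra hp
  obtain ⟨a, b, hab⟩ := (hM.coprime_iff_not_dvd).2 hp
  have h1 := congrArg (fun q => aeval M q *ᵥ v) hab
  simp only [map_add, map_mul, aeval_self_charpoly, Matrix.mul_zero, zero_add, ← mulVec_mulVec, h,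
    mulVec_zero, map_one, one_mulVec] at h1
  exact hv h1.symm

/-- If the characteristic polynomial is irreducible, every nonzero vector is cyclic: the space
has no proper nonzero invariant subspace. -/
theorem Matrix.exists_aeval_mulVec_eq {M : Matrix V V K} (hM : Irreducible M.charpoly)
    {v : V → K} (hv : v ≠ 0) (w : V → K) : ∃ p : K[X], aeval M p *ᵥ v = w := by
  let f : degreeLT K (Fintype.card V) →ₗ[K] (V → K) :=
    { toFun := fun p => aeval M (p : K[X]) *ᵥ v
      map_add' := fun p q => by simp [add_mulVec]
      map_smul' := fun c p => by simp [smul_mulVec] }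
  have hinj : Function.Injective f := by
    refine (injective_iff_map_eq_zero f).2 fun p hp => ?_
    have h1 := charpoly_dvd_of_aeval_mulVec_eq_zero hM hv hp
    have h2 := mem_degreeLT.1 p.2
    rw [← charpoly_degree_eq_dim M] at h2
    exact Subtype.ext (eq_zero_of_dvd_of_degree_lt h1 h2)
  have hdim : Module.finrank K (degreeLT K (Fintype.card V)) = Module.finrank K (V → K) := by
    rw [(degreeLTEquiv K (Fintype.card V)).finrank_eq]
    simp
  have : FiniteDimensional K (degreeLT K (Fintype.card V)) :=
    (degreeLTEquiv K (Fintype.card V)).symm.finiteDimensional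
  obtain ⟨p, hp⟩ := (LinearMap.injective_iff_surjective_of_finrank_eq_finrank hdim).1 hinj w
  exact ⟨p, hp⟩

theorem Matrix.nonempty_of_irreducible_charpoly {M : Matrix V V K} (hM : Irreducible M.charpoly) :
    Nonempty V := by
  by_contra h
  rw [not_nonempty_iff] at h
  exact hM.not_isUnit (by rw [charpoly_isEmpty]; exact isUnit_one)

/-- The commutant of a matrix with irreducible characteristic polynomial consists of the
polynomials in the matrix. -/
theorem Matrix.exists_eq_aeval_of_commute {M X : Matrix V V K} (hM : Irreducible M.charpoly)
    (hX : Commute M X) : ∃ p : K[X], X = aeval M p := by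
  have := nonempty_of_irreducible_charpoly hM
  have h1 : (1 : V → K) ≠ 0 := one_ne_zero
  obtain ⟨p, hp⟩ := exists_aeval_mulVec_eq hM h1 (X *ᵥ 1)
  refine ⟨p, ?_⟩
  refine Matrix.ext_iff_mulVec.2 fun v => ?_
  obtain ⟨q, rfl⟩ := exists_aeval_mulVec_eq hM h1 v
  have hc : Commute (aeval M q) X := by
    induction q using Polynomial.induction_on' with
    | add a b ha hb => rw [map_add]; exact ha.add_left hb
    | monomial n a =>
      rw [aeval_monomial]
      exact Commute.mul_left (Algebra.commutes a X) (hX.pow_left n)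
  rw [mulVec_mulVec, ← hc.eq, ← mulVec_mulVec, ← hp, mulVec_mulVec, mulVec_mulVec, ← map_mul,
    ← map_mul, mul_comm]

theorem Matrix.eq_zero_or_eq_zero_of_commute {M X Y : Matrix V V K} (hM : Irreducible M.charpoly)
    (hX : Commute M X) (hY : Commute M Y) (hXY : X * Y = 0) : X = 0 ∨ Y = 0 := by
  have := nonempty_of_irreducible_charpoly hM
  obtain ⟨p, rfl⟩ := exists_eq_aeval_of_commute hM hX
  obtain ⟨q, rfl⟩ := exists_eq_aeval_of_commute hM hY
  have h1 : M.charpoly ∣ p * q :=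
    charpoly_dvd_of_aeval_mulVec_eq_zero hM (one_ne_zero : (1 : V → K) ≠ 0)
      (by rw [map_mul, hXY, zero_mulVec])
  have h0 : ∀ r : K[X], M.charpoly ∣ r → aeval M r = 0 := by
    rintro _ ⟨s, rfl⟩
    rw [map_mul, aeval_self_charpoly, Matrix.zero_mul]
  exact (hM.prime.dvd_or_dvd h1).imp (h0 p) (h0 q)

end Cyclic

section Intertwiner

variable {V W : Type*} [Fintype V] [DecidableEq V] [Fintype W] [DecidableEq W]

theorem Matrix.IsSymm.aeval {K : Type*} [Field K] {A : Matrix V V K} (hA : A.IsSymm) (p : K[X]) :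
    (Polynomial.aeval A p).IsSymm := by
  rw [IsSymm]
  induction p using Polynomial.induction_on' with
  | add a b ha hb => rw [map_add, transpose_add, ha, hb]
  | monomial n a =>
    rw [← C_mul_X_pow_eq_monomial, ← smul_eq_C_mul, map_smul, map_pow, aeval_X, transpose_smul,
      transpose_pow, hA.eq]

theorem Matrix.dotProduct_aeval_mulVec {K : Type*} [Field K] {A : Matrix V V K} (hA : A.IsSymm)
    (p q : K[X]) (v w : V → K) :
    (aeval A p *ᵥ v) ⬝ᵥ (aeval A q *ᵥ w) = v ⬝ᵥ (aeval A (p * q) *ᵥ w) := by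
  rw [map_mul, ← mulVec_mulVec, dotProduct_mulVec v, ← mulVec_transpose, (hA.aeval p).eq]

/-- Two symmetric matrices with the same irreducible characteristic polynomial and the same
numbers of walks `eᵀ A ^ k e` are conjugate by an orthogonal matrix that fixes the all-one
vector `e`: it is the isometry `p(B) e ↦ p(A) e`. -/
theorem Matrix.exists_orthogonal_intertwiner {K : Type*} [Field K]
    {A : Matrix V V K} {B : Matrix W W K}
    (hA : A.IsSymm) (hB : B.IsSymm) (h : A.charpoly = B.charpoly) (hirr : Irreducible A.charpoly)
    (hw : ∀ k, (1 : V → K) ⬝ᵥ (A ^ k *ᵥ 1) = (1 : W → K) ⬝ᵥ (B ^ k *ᵥ 1)) :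
    ∃ Q : Matrix V W K, Qᵀ * Q = 1 ∧ Q * Qᵀ = 1 ∧ A * Q = Q * B ∧ Q *ᵥ 1 = 1 := by
  have hirr' : Irreducible B.charpoly := h ▸ hirr
  have := nonempty_of_irreducible_charpoly hirr
  have := nonempty_of_irreducible_charpoly hirr'
  have hcard : Fintype.card V = Fintype.card W := by
    rw [← charpoly_natDegree_eq_dim A, h, charpoly_natDegree_eq_dim]
  have h1 : (1 : W → K) ≠ 0 := one_ne_zero
  have hw' : ∀ p : K[X], (1 : V → K) ⬝ᵥ (aeval A p *ᵥ 1) = (1 : W → K) ⬝ᵥ (aeval B p *ᵥ 1) := by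
    intro p
    induction p using Polynomial.induction_on' with
    | add a b ha hb => simp only [map_add, add_mulVec, dotProduct_add, ha, hb]
    | monomial n a =>
      simp only [← C_mul_X_pow_eq_monomial, ← smul_eq_C_mul, map_smul, map_pow, aeval_X,
        smul_mulVec, dotProduct_smul, hw]
  choose c hc using fun v : W → K => exists_aeval_mulVec_eq hirr' h1 v
  have hcp : ∀ p : K[X], aeval A (c (aeval B p *ᵥ 1)) *ᵥ 1 = aeval A p *ᵥ (1 : V → K) := by
    intro p
    rw [← sub_eq_zero, ← sub_mulVec, ← map_sub]
    refine aeval_mulVec_eq_zero_of_charpoly_dvd ?_ _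
    rw [h]
    refine charpoly_dvd_of_aeval_mulVec_eq_zero hirr' h1 ?_
    rw [map_sub, sub_mulVec, hc, sub_self]
  let L : (W → K) →ₗ[K] (V → K) :=
    { toFun := fun v => aeval A (c v) *ᵥ 1
      map_add' := fun v w => by
        rw [← add_mulVec, ← map_add, ← hcp (c v + c w), map_add, add_mulVec, hc, hc]
      map_smul' := fun a v => by
        rw [RingHom.id_apply, ← smul_mulVec, ← map_smul, ← hcp (a • c v), map_smul, smul_mulVec,
          hc] }
  have hL : ∀ p : K[X], LinearMap.toMatrix' L *ᵥ (aeval B p *ᵥ 1) = aeval A p *ᵥ 1 := fun p => by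
    rw [LinearMap.toMatrix'_mulVec]
    exact hcp p
  set Q := LinearMap.toMatrix' L
  have hQ : Qᵀ * Q = 1 := by
    have key : ∀ v w : W → K, (Q *ᵥ v) ⬝ᵥ (Q *ᵥ w) = v ⬝ᵥ w := by
      intro v w
      rw [← hc v, ← hc w, hL, hL, dotProduct_aeval_mulVec hA, dotProduct_aeval_mulVec hB, hw']
    ext i j
    have := key (Pi.single i 1) (Pi.single j 1)
    simpa [mul_apply, dotProduct, one_apply, Pi.single_apply, eq_comm] using this
  refine ⟨Q, hQ, (mul_eq_one_comm_of_card_eq W V K hcard.symm).1 hQ, ?_, ?_⟩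
  · refine Matrix.ext_iff_mulVec.2 fun v => ?_
    rw [← hc v]
    have h2 := hL (X * c v)
    rw [map_mul, map_mul, aeval_X, aeval_X, ← mulVec_mulVec, ← mulVec_mulVec] at h2
    rw [← mulVec_mulVec, hL, ← mulVec_mulVec, h2]
  · simpa using hL 1

end Intertwiner

/-! ### Trees: potentials and perfect matchings -/

section Trees

variable {V : Type*}

/-- On a tree every signature is a coboundary: the potential `D v` is the product of the signs
along the path from a fixed root to `v`. -/
theorem SimpleGraph.IsTree.exists_potential {T : SimpleGraph V} (hT : T.IsTree)
    (σ : T.edgeSet → ℤˣ) :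
    ∃ D : V → ℤˣ, ∀ u v (h : T.Adj u v), σ ⟨s(u, v), h⟩ = D u * D v := by
  classical
  obtain ⟨r⟩ := hT.connected.nonempty
  choose p hp hu using hT.existsUnique_path r
  let σ' : Sym2 V → ℤˣ := fun e => if h : e ∈ T.edgeSet then σ ⟨e, h⟩ else 1
  refine ⟨fun v => ((p v).edges.map σ').prod, fun u v h => ?_⟩
  have step : ∀ {u v : V} (h : T.Adj u v), u ∈ (p v).support →
      σ ⟨s(u, v), h⟩ = ((p u).edges.map σ').prod * ((p v).edges.map σ').prod := by
    intro u v h hmem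
    have h1 : σ' s(u, v) = σ ⟨s(u, v), h⟩ := dif_pos (show s(u, v) ∈ T.edgeSet from h)
    rw [hT.isAcyclic.path_concat (hp u) (hp v) h hmem, SimpleGraph.Walk.edges_concat,
      List.concat_eq_append, List.map_append, List.prod_append, ← mul_assoc, Int.units_mul_self]
    simp [h1]
  by_cases hmem : u ∈ (p v).support
  · exact step h hmem
  · have h1 := step h.symm
      (hT.isAcyclic.mem_support_of_ne_mem_support_of_adj_of_isPath (hp u) (hp v) h hmem)
    rw [mul_comm, ← h1]
    congr 2
    exact Sym2.eq_swap

theorem SimpleGraph.IsTree.exists_bipartition {T : SimpleGraph V} (hT : T.IsTree) :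
    ∃ s : V → ℤˣ, ∀ u v, T.Adj u v → s u = -s v := by
  obtain ⟨s, hs⟩ := hT.exists_potential fun _ => -1
  refine ⟨s, fun u v h => ?_⟩
  have h1 : s u * s v = -1 := (hs u v h).symm
  rw [← mul_one (s u), ← Int.units_mul_self (s v), ← mul_assoc, h1, neg_one_mul]

theorem Finset.even_card_of_involution_ne {s : Finset V} {σ : V → V} (hs : ∀ i ∈ s, σ i ∈ s)
    (h2 : ∀ i ∈ s, σ (σ i) = i) (hne : ∀ i ∈ s, σ i ≠ i) : Even s.card := by
  have h : ∑ _i ∈ s, (1 : ZMod 2) = 0 :=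
    Finset.sum_involution (fun i _ => σ i) (fun _ _ => by decide) (fun i hi _ => hne i hi) hs h2
  rw [Finset.sum_const, nsmul_one, ZMod.natCast_eq_zero_iff] at h
  exact even_iff_two_dvd.2 h

variable [Fintype V] [DecidableEq V]

/-- The vertices on the side of `i` after the edge `ij` of a forest is removed: `j` lies on the
other side, and `ij` is the only edge between the sides. -/
theorem SimpleGraph.IsAcyclic.exists_side {T : SimpleGraph V} (hT : T.IsAcyclic) {i j : V}
    (h : T.Adj i j) : ∃ C : Finset V, i ∈ C ∧ j ∉ C ∧
      ∀ k ∈ C, ∀ l ∉ C, T.Adj k l → k = i ∧ l = j := by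
  classical
  have hb := isBridge_iff.1 (isAcyclic_iff_forall_adj_isBridge.1 hT h)
  refine ⟨Finset.univ.filter fun k => (T.deleteEdges {s(i, j)}).Reachable i k, by simp, by simpa,
    fun k hk l hl hkl => ?_⟩
  simp only [Finset.mem_filter, Finset.mem_univ, true_and] at hk hl
  have h1 : s(k, l) = s(i, j) := by
    by_contra hne
    exact hl (hk.trans (Adj.reachable (deleteEdges_adj.2 ⟨hkl, hne⟩)))
  rcases Sym2.eq_iff.1 h1 with h2 | ⟨rfl, rfl⟩
  · exact h2
  · exact absurd hk hb

/-- A permutation that moves every vertex of a forest to a neighbour is a matching. It crosses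
from the side of `i` to the side of `σ i` at `i`, hence crosses back somewhere, and only the edge
between `i` and `σ i` is available for that. -/
theorem SimpleGraph.IsAcyclic.perm_apply_apply {T : SimpleGraph V} (hT : T.IsAcyclic)
    {σ : Equiv.Perm V} (hσ : ∀ i, T.Adj i (σ i)) (i : V) : σ (σ i) = i := by
  obtain ⟨C, hi, hj, hC⟩ := hT.exists_side (hσ i)
  by_contra hne
  have h1 : ∀ k ∈ C, σ.symm k ∈ C := by
    intro k hk
    by_contra hk'
    have hadj : T.Adj k (σ.symm k) := by
      have := hσ (σ.symm k)
      rw [Equiv.apply_symm_apply] at this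
      exact this.symm
    obtain ⟨rfl, h3⟩ := hC k hk _ hk' hadj
    exact hne (by rw [← h3, Equiv.apply_symm_apply])
  obtain ⟨k, hk, hki⟩ :=
    Finset.surj_on_of_inj_on_of_card_le (fun k _ => σ.symm k) h1 (fun _ _ _ _ h => by simpa using h)
      le_rfl i hi
  rw [hki, Equiv.apply_symm_apply] at hj
  exact hj hk

/-- On a side of the edge `ij` a perfect matching pairs off all vertices, or all but `i`. -/
theorem SimpleGraph.IsAcyclic.perm_apply_eq_iff {T : SimpleGraph V} (hT : T.IsAcyclic)
    {σ : Equiv.Perm V} (hσ : ∀ i, T.Adj i (σ i)) {i j : V} {C : Finset V} (hi : i ∈ C)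
    (hj : j ∉ C) (hC : ∀ k ∈ C, ∀ l ∉ C, T.Adj k l → k = i ∧ l = j) :
    σ i = j ↔ Odd C.card := by
  have hinv := hT.perm_apply_apply hσ
  have hfix : ∀ k, σ k ≠ k := fun k => (hσ k).ne'
  constructor
  · intro h
    have h1 : Even (C.erase i).card := by
      refine Finset.even_card_of_involution_ne (σ := σ) (fun k hk => ?_) (fun k _ => hinv k)
        fun k _ => hfix k
      obtain ⟨hki, hkC⟩ := Finset.mem_erase.1 hk
      refine Finset.mem_erase.2 ⟨fun h2 => ?_, ?_⟩
      · rw [← hinv k, h2, h] at hkC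
        exact hj hkC
      · by_contra h2
        exact hki (hC k hkC _ h2 (hσ k)).1
    rw [← Finset.card_erase_add_one hi]
    exact h1.add_one
  · intro hodd
    by_contra h
    refine Nat.not_even_iff_odd.2 hodd (Finset.even_card_of_involution_ne (σ := σ)
      (fun k hk => ?_) (fun k _ => hinv k) fun k _ => hfix k)
    by_contra h2
    obtain ⟨rfl, h3⟩ := hC k hk _ h2 (hσ k)
    exact h h3

/-- A forest has at most one perfect matching: whether the edge `ij` is used is decided by the
parity of the component of `i` once `ij` is removed. -/
theorem SimpleGraph.IsAcyclic.perm_unique {T : SimpleGraph V} (hT : T.IsAcyclic)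
    {σ τ : Equiv.Perm V} (hσ : ∀ i, T.Adj i (σ i)) (hτ : ∀ i, T.Adj i (τ i)) : σ = τ := by
  ext i
  obtain ⟨C, hi, hj, hC⟩ := hT.exists_side (hσ i)
  exact ((hT.perm_apply_eq_iff hτ hi hj hC).2 ((hT.perm_apply_eq_iff hσ hi hj hC).1 rfl)).symm

theorem Equiv.Perm.sign_of_involution_ne {σ : Equiv.Perm V} (h : ∀ i, σ (σ i) = i)
    (hne : ∀ i, σ i ≠ i) : Equiv.Perm.sign σ = (-1) ^ (Fintype.card V / 2) := by
  have hpow : σ ^ 2 = 1 := by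
    ext i
    simp [pow_two, h]
  have hsupp : σ.support = Finset.univ := by
    ext i
    simp [hne]
  have h2 : ∀ c ∈ σ.cycleType, c = 2 := fun c hc =>
    le_antisymm (Nat.le_of_dvd two_pos
      ((Equiv.Perm.dvd_of_mem_cycleType hc).trans (orderOf_dvd_of_pow_eq_one hpow)))
      (Equiv.Perm.two_le_of_mem_cycleType hc)
  have hsum : σ.cycleType.sum = σ.cycleType.card * 2 := by
    rw [Multiset.eq_replicate_of_mem h2, Multiset.sum_replicate, Multiset.card_replicate,
      smul_eq_mul]
  have hcard : Fintype.card V = σ.cycleType.card * 2 := by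
    rw [← hsum, Equiv.Perm.sum_cycleType, hsupp, Finset.card_univ]
  rw [Equiv.Perm.sign_of_cycleType, hsum, hcard, Nat.mul_div_cancel _ two_pos, pow_add,
    mul_comm _ 2, (even_two_mul _).neg_one_pow, one_mul]

/-- At most one term of the Leibniz expansion of the determinant is nonzero, the one of the
perfect matching. -/
theorem SimpleGraph.IsAcyclic.det_adjMatrix {T : SimpleGraph V} [DecidableRel T.Adj]
    (hT : T.IsAcyclic) (h0 : (T.adjMatrix ℤ).det ≠ 0) :
    (T.adjMatrix ℤ).det = (-1) ^ (Fintype.card V / 2) := by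
  rw [det_apply] at h0 ⊢
  have hz : ∀ σ : Equiv.Perm V, (∃ i, ¬ T.Adj i (σ i)) →
      Equiv.Perm.sign σ • ∏ i, T.adjMatrix ℤ (σ i) i = 0 := by
    rintro σ ⟨i, hi⟩
    rw [Finset.prod_eq_zero (Finset.mem_univ i), smul_zero]
    rw [adjMatrix_apply, if_neg fun h => hi h.symm]
  obtain ⟨σ, -, hσ⟩ := Finset.exists_ne_zero_of_sum_ne_zero h0
  have hadj : ∀ i, T.Adj i (σ i) := by
    by_contra! h
    exact hσ (hz σ h)
  rw [Finset.sum_eq_single σ (fun τ _ hτ => ?_) (by simp)]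
  · rw [Finset.prod_eq_one fun i _ => by rw [adjMatrix_apply, if_pos (hadj i).symm]]
    rw [Equiv.Perm.sign_of_involution_ne (hT.perm_apply_apply hadj) fun i => (hadj i).ne']
    simp [Units.smul_def]
  · by_contra h
    refine hτ (hT.perm_unique (fun i => ?_) hadj)
    by_contra hi
    exact h (hz τ ⟨i, hi⟩)

end Trees

/-! ### Signed graphs and their adjacency matrices -/

namespace SignedGraph

section

variable {V : Type*} (Γ : SignedGraph V)

theorem adjMatrix_of_adj {i j : V} (h : Γ.graph.Adj i j) :
    Γ.adjMatrix i j = Γ.sign ⟨s(i, j), h⟩ := by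
  simp [adjMatrix, h]

theorem adjMatrix_of_not_adj {i j : V} (h : ¬ Γ.graph.Adj i j) : Γ.adjMatrix i j = 0 := by
  simp [adjMatrix, h]

theorem adjMatrix_ne_zero_iff {i j : V} : Γ.adjMatrix i j ≠ 0 ↔ Γ.graph.Adj i j := by
  by_cases h : Γ.graph.Adj i j
  · simp [adjMatrix_of_adj _ h, h]
  · simp [adjMatrix_of_not_adj _ h, h]

theorem isSymm_adjMatrix : Γ.adjMatrix.IsSymm := by
  refine IsSymm.ext fun i j => ?_
  by_cases h : Γ.graph.Adj i j
  · rw [adjMatrix_of_adj _ h, adjMatrix_of_adj _ h.symm]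
    congr 3
    exact Sym2.eq_swap
  · rw [adjMatrix_of_not_adj _ h, adjMatrix_of_not_adj _ fun h' => h h'.symm]

theorem exists_diagonal_anticommute (hT : Γ.graph.IsTree) :
    ∃ s : V → ℤˣ, ∀ i j, (s i : ℤ) * Γ.adjMatrix i j = -(Γ.adjMatrix i j * s j) := by
  obtain ⟨s, hs⟩ := hT.exists_bipartition
  refine ⟨s, fun i j => ?_⟩
  by_cases h : Γ.graph.Adj i j
  · rw [hs i j h, Units.val_neg]
    ring
  · rw [adjMatrix_of_not_adj _ h, mul_zero, zero_mul, neg_zero]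

variable [Fintype V]

theorem trace_adjMatrix_sq : (Γ.adjMatrix * Γ.adjMatrix).trace = 2 * Nat.card Γ.graph.edgeSet := by
  classical
  have h : (Γ.adjMatrix * Γ.adjMatrix).trace = ∑ i, (Γ.graph.degree i : ℤ) := by
    refine Finset.sum_congr rfl fun i _ => ?_
    rw [diag_apply, mul_apply, ← SimpleGraph.card_neighborFinset_eq_degree, Finset.card_eq_sum_ones,
      Nat.cast_sum, SimpleGraph.neighborFinset_eq_filter, Finset.sum_filter]
    refine Finset.sum_congr rfl fun j _ => ?_
    rw [Γ.isSymm_adjMatrix.apply i j]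
    by_cases hij : Γ.graph.Adj i j
    · rw [adjMatrix_of_adj _ hij, if_pos hij, ← Units.val_mul, Int.units_mul_self]
      rfl
    · rw [adjMatrix_of_not_adj _ hij, if_neg hij, zero_mul]
  rw [h, Nat.card_eq_fintype_card, ← SimpleGraph.edgeFinset_card]
  exact_mod_cast Γ.graph.sum_degrees_eq_twice_card_edges

theorem irreducible_charpoly_connected [DecidableEq V]
    (h : Irreducible (Γ.adjMatrix.map (Int.castRingHom ℚ)).charpoly) : Γ.graph.Connected := by
  classical
  have hne := nonempty_of_irreducible_charpoly h
  refine ⟨fun r v => ?_⟩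
  -- the projection onto the component of `r` commutes with the adjacency matrix
  let x : V → ℚ := fun i => if Γ.graph.Reachable r i then 1 else 0
  have hX : Commute (Γ.adjMatrix.map (Int.castRingHom ℚ)) (diagonal x) := by
    ext i j
    rw [mul_diagonal, diagonal_mul]
    by_cases hij : Γ.graph.Adj i j
    · have h1 : Γ.graph.Reachable r i ↔ Γ.graph.Reachable r j :=
        ⟨fun h => h.trans hij.reachable, fun h => h.trans hij.symm.reachable⟩
      simp only [x, h1]
      ring
    · simp [adjMatrix_of_not_adj _ hij]
  have hXX : diagonal x * (diagonal x - 1) = 0 := by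
    rw [← diagonal_one, diagonal_sub, diagonal_mul_diagonal, diagonal_eq_zero]
    ext i
    by_cases hi : Γ.graph.Reachable r i <;> simp [x, hi]
  rcases eq_zero_or_eq_zero_of_commute h hX (hX.sub_right (Commute.one_right _)) hXX with h0 | h0
  · have := congrFun (congrFun h0 r) r
    simp [x] at this
  · have := congrFun (congrFun h0 v) v
    by_contra hv
    simp [x, hv] at this

/-- Irreducibility of the characteristic polynomial makes the graph of `Γ'` connected, and the trace
of the square of the adjacency matrix counts its edges. -/
theorem isTree_of_trace_eq {W : Type*} [Fintype W] [DecidableEq W] {Γ' : SignedGraph W}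
    (hT : Γ.graph.IsTree) (hcard : Fintype.card V = Fintype.card W)
    (h : Irreducible (Γ'.adjMatrix.map (Int.castRingHom ℚ)).charpoly)
    (htr : (Γ.adjMatrix * Γ.adjMatrix).trace = (Γ'.adjMatrix * Γ'.adjMatrix).trace) :
    Γ'.graph.IsTree := by
  rw [SimpleGraph.isTree_iff_connected_and_card] at hT ⊢
  refine ⟨Γ'.irreducible_charpoly_connected h, ?_⟩
  rw [trace_adjMatrix_sq, trace_adjMatrix_sq] at htr
  have h2 := hT.2
  rw [Nat.card_eq_fintype_card (α := W)]
  rw [Nat.card_eq_fintype_card (α := V)] at h2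
  have h3 : (Nat.card Γ.graph.edgeSet : ℤ) = Nat.card Γ'.graph.edgeSet := by linarith
  have h4 : Nat.card Γ.graph.edgeSet = Nat.card Γ'.graph.edgeSet := by exact_mod_cast h3
  omega

variable [DecidableEq V]

/-- A signed tree is switching equivalent to its underlying tree. -/
theorem exists_diagonal_mul_adjMatrix_mul [DecidableRel Γ.graph.Adj] (hT : Γ.graph.IsTree) :
    ∃ D : V → ℤˣ, Γ.adjMatrix = diagonal (fun i => (D i : ℤ)) * Γ.graph.adjMatrix ℤ *
      diagonal fun i => (D i : ℤ) := by
  obtain ⟨D, hD⟩ := hT.exists_potential Γ.sign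
  refine ⟨D, ?_⟩
  ext i j
  rw [mul_diagonal, diagonal_mul, SimpleGraph.adjMatrix_apply]
  by_cases h : Γ.graph.Adj i j
  · rw [adjMatrix_of_adj _ h, hD, if_pos h, Units.val_mul, mul_one]
  · rw [adjMatrix_of_not_adj _ h, if_neg h, mul_zero, zero_mul]

theorem charpoly_adjMatrix_of_isTree [DecidableRel Γ.graph.Adj] (hT : Γ.graph.IsTree) :
    Γ.adjMatrix.charpoly = (Γ.graph.adjMatrix ℤ).charpoly := by
  obtain ⟨D, hD⟩ := Γ.exists_diagonal_mul_adjMatrix_mul hT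
  rw [hD, mul_assoc, charpoly_mul_comm, mul_assoc, diagonal_mul_diagonal]
  simp [← Units.val_mul]

end

end SignedGraph

/-! ### Discriminants and integral elements -/

section Discriminant

variable {K : Type*} [Field K] [Algebra ℚ K]

theorem PowerBasis.norm_aeval_derivative (pb : PowerBasis ℚ K) {f : ℤ[X]} (hf : f.Monic)
    (hdeg : 0 < f.natDegree) (hmin : minpoly ℚ pb.gen = f.map (Int.castRingHom ℚ)) :
    Algebra.norm ℚ (aeval pb.gen f.derivative) =
      (-1) ^ (f.natDegree * (f.natDegree - 1) / 2) * (f.discr : ℚ) := by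
  have : FiniteDimensional ℚ K := pb.finite
  let E := AlgebraicClosure ℚ
  apply (algebraMap ℚ E).injective
  have hres := resultant_deriv (natDegree_pos_iff_degree_pos.1 hdeg)
  rw [hf.leadingCoeff, mul_one] at hres
  have h1 := resultant_map_map f f.derivative f.natDegree (f.natDegree - 1) (Int.castRingHom E)
  have hfE : (f.map (Int.castRingHom E)).natDegree = f.natDegree := hf.natDegree_map _
  have h2 := resultant_eq_prod_eval (f.map (Int.castRingHom E))
    (f.derivative.map (Int.castRingHom E)) (f.natDegree - 1)
    (natDegree_map_le.trans (natDegree_derivative_le f)) (IsAlgClosed.splits _)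
  rw [hfE, (hf.map _).leadingCoeff, one_pow, one_mul, h1, hres] at h2
  have hE : (minpoly ℚ pb.gen).map (algebraMap ℚ E) = f.map (Int.castRingHom E) := by
    rw [hmin, Polynomial.map_map]
    congr 1
  have hnodup : (f.map (Int.castRingHom E)).roots.Nodup := by
    rw [← hE]
    exact nodup_roots (Separable.map (Algebra.IsSeparable.isSeparable ℚ pb.gen))
  have h3 : algebraMap ℚ E (Algebra.norm ℚ (aeval pb.gen f.derivative)) =
      ((f.map (Int.castRingHom E)).roots.map (f.derivative.map (Int.castRingHom E)).eval).prod := by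
    rw [Algebra.norm_eq_prod_embeddings ℚ E]
    classical
    rw [Fintype.prod_equiv pb.liftEquiv' _
      (fun x => (f.derivative.map (Int.castRingHom E)).eval (x : E)) (fun σ => ?_)]
    · rw [Finset.prod_mem_multiset _ _ (f.derivative.map (Int.castRingHom E)).eval fun _ => rfl,
        ← hE, Finset.prod_eq_multiset_prod, Multiset.toFinset_val, Multiset.dedup_eq_self.mpr]
      rwa [aroots_def, hE]
    · rw [PowerBasis.liftEquiv'_apply_coe, eval_map, aeval_def]
      exact (hom_eval₂ _ _ (σ : K →+* E) _).trans (by congr 1; exact RingHom.ext_int _ _)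
  rw [h3, ← h2]
  simp

theorem PowerBasis.discr_eq_discr (pb : PowerBasis ℚ K) {f : ℤ[X]} (hf : f.Monic)
    (hdeg : 0 < f.natDegree) (hmin : minpoly ℚ pb.gen = f.map (Int.castRingHom ℚ)) :
    Algebra.discr ℚ pb.basis = f.discr := by
  have : FiniteDimensional ℚ K := pb.finite
  have hn : Module.finrank ℚ K = f.natDegree := by
    rw [pb.finrank, ← pb.natDegree_minpoly, hmin, hf.natDegree_map]
  rw [Algebra.discr_powerBasis_eq_norm, hmin, derivative_map, hn,
    show (aeval pb.gen) (Polynomial.map (Int.castRingHom ℚ) (derivative f)) =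
      aeval pb.gen f.derivative from aeval_map_algebraMap ℚ pb.gen f.derivative,
    pb.norm_aeval_derivative hf hdeg hmin, ← mul_assoc, ← pow_add, ← two_mul,
    (even_two_mul _).neg_one_pow, one_mul]

/-- If the discriminant of `f` is squarefree, then `ℤ[x] / (f)` is integrally closed: replacing
`x ^ k` in the power basis by the integral element `g(x)` multiplies the discriminant by the square
of the coefficient of `x ^ k` in `g`. -/
theorem PowerBasis.exists_int_coeff_of_isIntegral (pb : PowerBasis ℚ K) {f : ℤ[X]} (hf : f.Monic)
    (hdeg : 0 < f.natDegree) (hmin : minpoly ℚ pb.gen = f.map (Int.castRingHom ℚ))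
    (hsq : Squarefree f.discr) {g : ℚ[X]} (hg : g.natDegree < f.natDegree)
    (hint : IsIntegral ℤ (aeval pb.gen g)) (k : ℕ) (hk : k < f.natDegree) :
    ∃ z : ℤ, g.coeff k = z := by
  have : FiniteDimensional ℚ K := pb.finite
  have hdim : pb.dim = f.natDegree := by
    rw [← pb.natDegree_minpoly, hmin, hf.natDegree_map]
  let k' : Fin pb.dim := ⟨k, by omega⟩
  -- the base change that replaces the basis element `x ^ k` by `g(x)`; its determinant is the
  -- coefficient of `x ^ k` in `g`
  let P : Matrix (Fin pb.dim) (Fin pb.dim) ℚ := (1 : Matrix _ _ ℚ).updateRow k' fun i => g.coeff i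
  have hP : P.det = g.coeff k := by
    rw [← cramer_transpose_apply, transpose_one, cramer_one]
    rfl
  have hgen : IsIntegral ℤ pb.gen := ⟨f, hf, by
    have := minpoly.aeval ℚ pb.gen
    rw [hmin] at this
    rwa [show Int.castRingHom ℚ = algebraMap ℤ ℚ from rfl, aeval_map_algebraMap] at this⟩
  have hb : ∀ i, IsIntegral ℤ ((P.map (algebraMap ℚ K) *ᵥ pb.basis) i) := by
    intro i
    by_cases hi : i = k'
    · have h2 : ((P.map (algebraMap ℚ K) *ᵥ pb.basis) i) = aeval pb.gen g := by
        rw [aeval_eq_sum_range' (n := pb.dim) (by rw [hdim]; exact hg), ← Fin.sum_univ_eq_sum_range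
          (fun i => g.coeff i • pb.gen ^ i), hi]
        rw [mulVec, dotProduct]
        refine Finset.sum_congr rfl fun j _ => ?_
        simp [P, Algebra.smul_def]
      rwa [h2]
    · have h2 : ((P.map (algebraMap ℚ K) *ᵥ pb.basis) i) = pb.gen ^ (i : ℕ) := by
        rw [mulVec, dotProduct, Finset.sum_eq_single i (fun j _ hj => ?_) (by simp)]
        · simp [P, updateRow_ne hi]
        · simp [P, updateRow_ne hi, one_apply_ne hj.symm]
      rw [h2]
      exact hgen.pow _
  have h1 := Algebra.discr_isIntegral (K := ℚ) hb
  rw [Algebra.discr_of_matrix_mulVec, hP, pb.discr_eq_discr hf hdeg hmin] at h1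
  obtain ⟨z, hz⟩ := IsIntegrallyClosed.isIntegral_iff.1 h1
  -- with `g.coeff k = a / b` in lowest terms, `b ^ 2` divides the discriminant
  set q := g.coeff k
  have h2 : (q.den : ℤ) * q.den ∣ f.discr := by
    have h3 : f.discr * q.num ^ 2 = q.den * q.den * z := by
      have h5 : ((f.discr * q.num ^ 2 : ℤ) : ℚ) = ((q.den * q.den * z : ℤ) : ℚ) := by
        push_cast
        rw [show (z : ℚ) = _ from hz, ← Rat.mul_den_eq_num]
        ring
      exact_mod_cast h5
    have hco : IsCoprime (q.den : ℤ) (q.num ^ 2) :=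
      ((Int.isCoprime_iff_nat_coprime (a := (q.den : ℤ)) (b := q.num)).2
        (by rw [Int.natAbs_natCast]; exact q.reduced.symm)).pow_right
    exact (hco.mul_left hco).dvd_of_dvd_mul_right ⟨z, h3⟩
  have h4 := Int.isUnit_iff.1 (hsq _ h2)
  refine ⟨q.num, ?_⟩
  have h5 : q.den = 1 := by omega
  exact (Rat.coe_int_num_of_den_eq_one h5).symm

end Discriminant

/-! ### The discriminant of `f(x ^ 2)` -/

section Expand

variable {F K : Type*} [Field F] [Algebra ℚ F] [Field K] [Algebra ℚ K]

/-- If the generator of `K` is a root of `g(x ^ 2)` and that of `F` is a root of `g`, then `F`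
embeds into `K` in such a way that its generator becomes the square of that of `K`. -/
theorem PowerBasis.exists_algHom_sq (pF : PowerBasis ℚ F) (pK : PowerBasis ℚ K)
    (h : minpoly ℚ pK.gen = expand ℚ 2 (minpoly ℚ pF.gen)) :
    ∃ ι : F →ₐ[ℚ] K, ι pF.gen = pK.gen ^ 2 := by
  have h1 : aeval (pK.gen ^ 2) (minpoly ℚ pF.gen) = 0 := by
    rw [← expand_aeval, ← h, minpoly.aeval]
  exact ⟨pF.lift _ h1, pF.lift_gen _ h1⟩

/-- The discriminant of `f(x ^ 2)`, computed from the norm of its derivative `2 x f'(x ^ 2)` at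
a root, the factor `f'(x ^ 2)` of which lies in the subfield generated by `x ^ 2`. -/
theorem PowerBasis.discr_expand_two (pF : PowerBasis ℚ F) (pK : PowerBasis ℚ K) {f : ℤ[X]}
    (hf : f.Monic) (hdeg : 0 < f.natDegree)
    (hminF : minpoly ℚ pF.gen = f.map (Int.castRingHom ℚ))
    (hminK : minpoly ℚ pK.gen = (expand ℤ 2 f).map (Int.castRingHom ℚ)) :
    (expand ℤ 2 f).discr = (-4) ^ f.natDegree * f.coeff 0 * f.discr ^ 2 := by
  have hF := pF.norm_aeval_derivative hf hdeg hminF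
  have hK := pK.norm_aeval_derivative (f := expand ℤ 2 f) (hf.expand two_pos)
    (by rw [natDegree_expand]; omega) hminK
  obtain ⟨ι, hι⟩ := pF.exists_algHom_sq pK (by rw [hminF, hminK, map_expand])
  have : FiniteDimensional ℚ F := pF.finite
  have : FiniteDimensional ℚ K := pK.finite
  let algFK : Algebra F K := ι.toRingHom.toAlgebra
  have : IsScalarTower ℚ F K := IsScalarTower.of_algHom ι
  have : FiniteDimensional F K := FiniteDimensional.right ℚ F K
  have hfF : Module.finrank ℚ F = f.natDegree := by
    rw [pF.finrank, ← pF.natDegree_minpoly, hminF, hf.natDegree_map]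
  have hdimK : pK.dim = 2 * f.natDegree := by
    rw [← pK.natDegree_minpoly, hminK, (hf.expand two_pos).natDegree_map, natDegree_expand,
      mul_comm]
  have hfK : Module.finrank ℚ K = 2 * f.natDegree := by rw [pK.finrank, hdimK]
  have hfFK : Module.finrank F K = 2 := by
    have := Module.finrank_mul_finrank ℚ F K
    rw [hfF, hfK, mul_comm] at this
    exact Nat.eq_of_mul_eq_mul_right hdeg this
  have hnorm : ∀ x : F, Algebra.norm ℚ (ι x) = Algebra.norm ℚ x ^ 2 := by
    intro x
    rw [← Algebra.norm_norm (R := ℚ) (S := F) (a := ι x),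
      show ι x = algebraMap F K x from rfl, Algebra.norm_algebraMap, hfFK, map_pow]
  have hroot : Algebra.norm ℚ pK.gen = f.coeff 0 := by
    rw [Algebra.PowerBasis.norm_gen_eq_coeff_zero_minpoly pK, hdimK,
      (even_two_mul _).neg_one_pow, one_mul, hminK, coeff_map, coeff_expand two_pos,
      if_pos (dvd_zero 2), Nat.zero_div]
    rfl
  have hval : aeval pK.gen (derivative (expand ℤ 2 f)) =
      ι (aeval pF.gen (derivative f)) * (algebraMap ℚ K 2 * pK.gen) := by
    have h1 : ι (aeval pF.gen (derivative f)) = aeval (ι pF.gen) (derivative f) :=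
      (hom_eval₂ _ _ (ι : F →+* K) _).trans (by rw [aeval_def]; congr 1; exact RingHom.ext_int _ _)
    rw [h1, derivative_expand, map_mul, expand_aeval, hι, map_mul, map_natCast, Nat.cast_ofNat,
      map_ofNat, pow_one, aeval_X]
  rw [hval, map_mul, map_mul, hnorm, hF, Algebra.norm_algebraMap, hfK, hroot, natDegree_expand]
    at hK
  have h2 : f.natDegree * 2 * (f.natDegree * 2 - 1) / 2 = f.natDegree * (f.natDegree * 2 - 1) := by
    rw [mul_assoc, mul_left_comm, Nat.mul_div_cancel_left _ two_pos]
  have h3 : (-1 : ℚ) ^ (f.natDegree * (f.natDegree * 2 - 1)) = (-1) ^ f.natDegree := by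
    rw [mul_comm, pow_mul, Odd.neg_one_pow ⟨f.natDegree - 1, by omega⟩]
  rw [h2, h3, mul_pow, ← pow_mul, mul_comm _ 2, (even_two_mul _).neg_one_pow, one_mul] at hK
  have h4 : ((expand ℤ 2 f).discr : ℚ) =
      (((-4) ^ f.natDegree * f.coeff 0 * f.discr ^ 2 : ℤ) : ℚ) := by
    have h5 : (-1 : ℚ) ^ f.natDegree * (-1) ^ f.natDegree = 1 := by
      rw [← mul_pow]
      norm_num
    rw [← one_mul ((expand ℤ 2 f).discr : ℚ), ← h5, mul_assoc, ← hK]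
    push_cast
    rw [show (-4 : ℚ) = -1 * 2 ^ 2 by norm_num, mul_pow, ← pow_mul]
    ring
  exact_mod_cast h4

end Expand

/-! ### Parity of the adjugate for bipartite graphs -/

section Parity

theorem Polynomial.coeff_comp_neg_X {R : Type*} [CommRing R] (p : R[X]) (k : ℕ) :
    (p.comp (-X)).coeff k = p.coeff k * (-1) ^ k := by
  rw [← comp_C_mul_X_coeff, map_neg, map_one, neg_one_mul]

section

variable {R : Type*} [CommRing R] [IsDomain R] [CharZero R]

theorem Polynomial.eq_expand_two_of_comp_neg_X {p : R[X]} (h : p.comp (-X) = p) :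
    p = expand R 2 (contract 2 p) := by
  ext k
  rw [coeff_expand two_pos]
  split_ifs with hk
  · rw [coeff_contract two_ne_zero, Nat.div_mul_cancel hk]
  · have h1 := congrArg (fun q => q.coeff k) h
    simp only [coeff_comp_neg_X] at h1
    rw [(Nat.odd_iff.2 (by omega)).neg_one_pow] at h1
    simpa [neg_eq_iff_add_eq_zero, ← two_mul] using h1

theorem Polynomial.eq_X_mul_expand_two_of_comp_neg_X {p : R[X]} (h : p.comp (-X) = -p) :
    p = X * expand R 2 (contract 2 p.divX) := by
  have h0 : p.coeff 0 = 0 := by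
    have h1 := congrArg (fun q => q.coeff 0) h
    simp only [coeff_comp_neg_X] at h1
    simpa [eq_neg_iff_add_eq_zero, ← two_mul] using h1
  obtain ⟨q, rfl⟩ := X_dvd_iff.2 h0
  have hq : (X * q).divX = q := by
    ext k
    rw [coeff_divX, coeff_X_mul]
  rw [hq]
  rw [mul_comp, X_comp, neg_mul, neg_inj] at h
  rw [← eq_expand_two_of_comp_neg_X (mul_left_cancel₀ X_ne_zero h)]

end

variable {R : Type*} [CommRing R]
variable {V : Type*} [Fintype V] [DecidableEq V] {s : V → ℤˣ} {M : Matrix V V R}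

theorem Matrix.charmatrix_map_comp_neg_X
    (h : ∀ i j, ((s i : ℤ) : R) * M i j = -(M i j * ((s j : ℤ) : R))) :
    (compRingHom (-X)).mapMatrix M.charmatrix =
      -(diagonal (fun i => ((s i : ℤ) : R[X])) * M.charmatrix *
        diagonal fun i => ((s i : ℤ) : R[X])) := by
  have hs : ∀ i, ((s i : ℤ) : R[X]) * ((s i : ℤ) : R[X]) = 1 := fun i => by
    rw [← Int.cast_mul, ← Units.val_mul, Int.units_mul_self]
    simp
  have hs' : ∀ i, ((s i : ℤ) : R) * ((s i : ℤ) : R) = 1 := fun i => by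
    rw [← Int.cast_mul, ← Units.val_mul, Int.units_mul_self]
    simp
  have key : ∀ i j, ((s i : ℤ) : R[X]) * C (M i j) * ((s j : ℤ) : R[X]) = -C (M i j) := by
    intro i j
    have h1 : ((s i : ℤ) : R) * M i j * ((s j : ℤ) : R) = - M i j := by
      rw [h i j, neg_mul, mul_assoc, hs', mul_one]
    rw [← C_neg, ← h1]
    simp
  ext1 i j
  rw [RingHom.mapMatrix_apply, map_apply, coe_compRingHom_apply, neg_apply, mul_diagonal,
    diagonal_mul]
  by_cases hij : i = j
  · subst hij
    rw [charmatrix_apply_eq, mul_sub, sub_mul, key, sub_comp, X_comp, C_comp, mul_right_comm, hs]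
    ring
  · rw [charmatrix_apply_ne _ _ _ hij, neg_comp, C_comp, mul_neg, neg_mul, neg_neg, key]

/-- The characteristic polynomial of the adjacency matrix of a bipartite graph is even or odd. -/
theorem Matrix.charpoly_comp_neg_X
    (h : ∀ i j, ((s i : ℤ) : R) * M i j = -(M i j * ((s j : ℤ) : R))) :
    M.charpoly.comp (-X) = (-1) ^ Fintype.card V * M.charpoly := by
  rw [← coe_compRingHom_apply, Matrix.charpoly, RingHom.map_det, charmatrix_map_comp_neg_X h,
    det_neg, det_mul_right_comm, diagonal_mul_diagonal]
  congr 1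
  rw [show (fun i => ((s i : ℤ) : R[X]) * ((s i : ℤ) : R[X])) = fun _ => 1 from ?_,
    diagonal_one, Matrix.one_mul]
  ext1 i
  rw [← Int.cast_mul, ← Units.val_mul, Int.units_mul_self]
  simp

theorem Matrix.adjugate_charmatrix_comp_neg_X
    (h : ∀ i j, ((s i : ℤ) : R) * M i j = -(M i j * ((s j : ℤ) : R)))
    (hcard : Even (Fintype.card V)) (i j : V) :
    (M.charmatrix.adjugate i j).comp (-X) =
      -(((s i : ℤ) : R[X]) * M.charmatrix.adjugate i j * ((s j : ℤ) : R[X])) := by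
  have hss : diagonal (fun i => ((s i : ℤ) : R[X])) *
      diagonal (fun i => ((s i : ℤ) : R[X])) = 1 := by
    rw [diagonal_mul_diagonal, ← diagonal_one]
    congr 1
    ext1 i
    rw [← Int.cast_mul, ← Units.val_mul, Int.units_mul_self]
    simp
  set S := diagonal (fun i => ((s i : ℤ) : R[X])) with hS
  have hadj : S.adjugate = S.det • S := by
    rw [← Matrix.mul_one S.adjugate, ← hss, ← Matrix.mul_assoc, adjugate_mul, Matrix.smul_mul,
      Matrix.one_mul]
  have hdet : S.det * S.det = 1 := by rw [← det_mul, hss, det_one]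
  have hodd : Odd (Fintype.card V - 1) := by
    have := Fintype.card_pos_iff.2 ⟨i⟩
    exact Nat.Even.sub_odd (by omega) hcard odd_one
  have h2 : ((compRingHom (-X)).mapMatrix M.charmatrix).adjugate =
      -(S * M.charmatrix.adjugate * S) := by
    rw [charmatrix_map_comp_neg_X h, ← hS, ← neg_one_smul R[X], adjugate_smul, hodd.neg_one_pow,
      adjugate_mul_distrib, adjugate_mul_distrib, hadj, Matrix.smul_mul, Matrix.mul_smul,
      Matrix.mul_smul, smul_smul, smul_smul, mul_assoc, hdet, mul_one, neg_one_smul,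
      Matrix.mul_assoc]
  rw [← RingHom.map_adjugate] at h2
  have h3 := congrFun (congrFun h2 i) j
  rwa [RingHom.mapMatrix_apply, map_apply, coe_compRingHom_apply, neg_apply, hS, mul_diagonal,
    diagonal_mul] at h3

end Parity

/-! ### Rank one at a simple eigenvalue -/

section RankOne

variable {V W : Type*} [Fintype V] [DecidableEq V] [Fintype W] [DecidableEq W]

/-- At a simple eigenvalue the adjugate of `λ I - M` has rank at most one, since its columns lie
in the eigenspace. -/
theorem Matrix.exists_adjugate_eq_vecMulVec {K : Type*} [Field K] (M : Matrix V V K) {μ : K}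
    (hroot : M.charpoly.IsRoot μ) (hsep : M.charpoly.Separable) :
    ∃ v c : V → K, (scalar V μ - M).adjugate = vecMulVec v c := by
  have hfin : Module.finrank K (Module.End.eigenspace (toLin' M) μ) ≤ 1 := by
    refine (LinearMap.finrank_eigenspace_le (toLin' M) μ).trans ?_
    rw [Matrix.charpoly_toLin']
    exact rootMultiplicity_le_one_of_separable hsep μ
  obtain ⟨v, hv⟩ := finrank_le_one_iff.1 hfin
  have hmul : (scalar V μ - M) * (scalar V μ - M).adjugate = 0 := by
    rw [mul_adjugate, ← eval_charpoly, hroot.eq_zero, zero_smul]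
  have hmem : ∀ j, (scalar V μ - M).adjugate.col j ∈ Module.End.eigenspace (toLin' M) μ := by
    intro j
    rw [Module.End.mem_eigenspace_iff, toLin'_apply, eq_comm, ← sub_eq_zero]
    ext i
    have h1 := congrFun (congrFun hmul i) j
    rw [Matrix.sub_mul, sub_apply, scalar_apply, diagonal_mul] at h1
    exact h1
  choose c hc using fun j => hv ⟨_, hmem j⟩
  refine ⟨v, c, ?_⟩
  ext i j
  have h1 := congrFun (congrArg Subtype.val (hc j)) i
  simp only [SetLike.val_smul, Pi.smul_apply, smul_eq_mul] at h1
  rw [vecMulVec_apply, mul_comm]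
  exact h1.symm

/-- For a symmetric `P = v cᵀ`, the entry `(P Q)_ij` can be computed with the roles of `v` and `c`
exchanged; the square is the product of the two expressions. -/
theorem Matrix.mul_apply_sq_of_vecMulVec {V W K : Type*} [Fintype V] [CommRing K] {P : Matrix V V K}
    (hP : P.IsSymm) {v c : V → K} (h : P = vecMulVec v c) (Q : Matrix V W K) (i : V) (j : W) :
    (P * Q) i j ^ 2 = P i i * (Qᵀ * P * Q) j j := by
  have h' : P = vecMulVec c v := by rw [← hP.eq, h, transpose_vecMulVec]
  have h1 : (P * Q) i j = v i * (c ᵥ* Q) j := by rw [h, vecMulVec_mul, vecMulVec_apply]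
  have h2 : (P * Q) i j = c i * (v ᵥ* Q) j := by rw [h', vecMulVec_mul, vecMulVec_apply]
  have h3 : (Qᵀ * P * Q) j j = (v ᵥ* Q) j * (c ᵥ* Q) j := by
    rw [h, mul_vecMulVec, vecMulVec_mul, vecMulVec_apply, mulVec_transpose]
  rw [pow_two]
  nth_rewrite 1 [h1]
  rw [h2, h3, h, vecMulVec_apply]
  ring

theorem Matrix.transpose_mul_adjugate_charmatrix_mul {R : Type*} [CommRing R] [IsDomain R]
    {A : Matrix V V R} {B : Matrix W W R} {Q : Matrix V W R} (h : A.charpoly = B.charpoly)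
    (hQ : Qᵀ * Q = 1) (hAB : A * Q = Q * B) :
    (Q.map C)ᵀ * A.charmatrix.adjugate * Q.map C = B.charmatrix.adjugate := by
  have hQ' : (Q.map C)ᵀ * Q.map C = 1 := by
    rw [← transpose_map, ← Matrix.map_mul, hQ, Matrix.map_one _ (map_zero C) (map_one C)]
  have hint : A.charmatrix * Q.map C = Q.map C * B.charmatrix := by
    have h1 : A.map C * Q.map C = Q.map C * B.map C := by
      rw [← Matrix.map_mul, ← Matrix.map_mul, hAB]
    rw [charmatrix, charmatrix, Matrix.sub_mul, Matrix.mul_sub, RingHom.mapMatrix_apply,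
      RingHom.mapMatrix_apply, h1]
    congr 1
    ext1 i j
    rw [scalar_apply, scalar_apply, diagonal_mul, mul_diagonal, mul_comm]
  have h1 : (Q.map C)ᵀ * A.charmatrix.adjugate * Q.map C * B.charmatrix =
      B.charmatrix.adjugate * B.charmatrix := by
    rw [Matrix.mul_assoc, ← hint, Matrix.mul_assoc, ← Matrix.mul_assoc A.charmatrix.adjugate,
      adjugate_mul, adjugate_mul, Matrix.smul_mul, Matrix.one_mul, Matrix.mul_smul, hQ',
      ← Matrix.charpoly, h, Matrix.charpoly]
  have h2 := congrArg (fun N => N * B.charmatrix.adjugate) h1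
  simp only [Matrix.mul_assoc _ B.charmatrix, mul_adjugate, Matrix.mul_smul, Matrix.mul_one] at h2
  exact smul_right_injective _ B.charpoly_monic.ne_zero h2

end RankOne

/-! ### Integrality of the intertwining matrix -/

section Integrality

variable {V W : Type*} [Fintype V] [DecidableEq V] [Fintype W] [DecidableEq W]

theorem Matrix.isSymm_map_adjugate_charmatrix {R S : Type*} [CommRing R] [CommRing S]
    {M : Matrix V V R} (hM : M.IsSymm) (f : R[X] →+* S) :
    (f.mapMatrix M.charmatrix.adjugate).IsSymm := by
  rw [IsSymm, RingHom.mapMatrix_apply, ← transpose_map, adjugate_transpose, ← charmatrix_transpose,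
    hM.eq]

/-- At a root of the common characteristic polynomial of `A` and `Qᵀ A Q`, the square of an entry
of `adj (x I - A) Q` is the product of two diagonal entries of the adjugates. -/
theorem Matrix.aeval_adjugate_mul_sq {K F : Type*} [Field K] [Field F] [Algebra F K]
    {A : Matrix V V F} {B : Matrix W W F} {Q : Matrix V W F} (hA : A.IsSymm)
    (h : A.charpoly = B.charpoly) (hQ : Qᵀ * Q = 1) (hAB : A * Q = Q * B)
    (hsep : A.charpoly.Separable) {μ : K} (hμ : aeval μ A.charpoly = 0) (i : V) (j : W) :
    aeval μ ((A.charmatrix.adjugate * Q.map C) i j) ^ 2 =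
      aeval μ (A.charmatrix.adjugate i i) * aeval μ (B.charmatrix.adjugate j j) := by
  let θ : F[X] →+* K := (aeval μ : F[X] →ₐ[F] K)
  have hchar : θ.mapMatrix A.charmatrix = scalar V μ - A.map (algebraMap F K) := by
    ext k l
    rw [RingHom.mapMatrix_apply, map_apply, sub_apply, scalar_apply, map_apply]
    by_cases hkl : k = l
    · subst hkl
      simp [θ]
    · simp [θ, hkl]
  have hcm : (A.map (algebraMap F K)).charpoly = A.charpoly.map (algebraMap F K) :=
    charpoly_map A (algebraMap F K)
  obtain ⟨v, c, hvc⟩ := exists_adjugate_eq_vecMulVec (A.map (algebraMap F K)) (μ := μ)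
    (by rwa [hcm, IsRoot.def, eval_map_algebraMap]) (by rw [hcm]; exact hsep.map)
  rw [← hchar, ← RingHom.map_adjugate] at hvc
  have key := mul_apply_sq_of_vecMulVec (isSymm_map_adjugate_charmatrix hA θ) hvc
    ((Q.map C).map θ) i j
  rw [RingHom.mapMatrix_apply, ← transpose_map, ← Matrix.map_mul, ← Matrix.map_mul,
    ← Matrix.map_mul, transpose_mul_adjugate_charmatrix_mul h hQ hAB] at key
  exact key

/-- If the common characteristic polynomial of two integral symmetric matrices is `f(x ^ 2)`, where
`ℤ[x] / (f)` has squarefree discriminant, then every rational orthogonal matrix that conjugates one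
into the other and respects the bipartitions is integral. -/
theorem Matrix.exists_int_apply_of_intertwiner {A : Matrix V V ℤ} {B : Matrix W W ℤ}
    {Q : Matrix V W ℚ} {f : ℤ[X]} (hf : f.Monic) (hAf : A.charpoly = expand ℤ 2 f)
    (hBf : B.charpoly = expand ℤ 2 f) (hsq : Squarefree f.discr)
    {K F : Type*} [Field K] [Field F] [Algebra ℚ F] [Algebra ℚ K]
    (pF : PowerBasis ℚ F) (pK : PowerBasis ℚ K)
    (hminF : minpoly ℚ pF.gen = f.map (Int.castRingHom ℚ))
    (hminK : minpoly ℚ pK.gen = (expand ℤ 2 f).map (Int.castRingHom ℚ))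
    (hA : A.IsSymm) (hQ : Qᵀ * Q = 1)
    (hAB : A.map (Int.castRingHom ℚ) * Q = Q * B.map (Int.castRingHom ℚ))
    {s : V → ℤˣ} {t : W → ℤˣ} (hs : ∀ i j, (s i : ℤ) * A i j = -(A i j * s j))
    (ht : ∀ i j, (t i : ℤ) * B i j = -(B i j * t j))
    (hst : ∀ i j, ((s i : ℤ) : ℚ) * Q i j = Q i j * ((t j : ℤ) : ℚ)) (i : V) (j : W) :
    ∃ z : ℤ, Q i j = z := by
  have hsplit : s i = t j ∨ s i = -t j := by
    rcases Int.units_eq_one_or (s i) with h1 | h1 <;>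
      rcases Int.units_eq_one_or (t j) with h2 | h2 <;> simp [h1, h2]
  rcases hsplit with hij | hij
  swap
  -- an entry between opposite sides of the bipartitions vanishes
  · have h1 := hst i j
    rw [hij] at h1
    have h2 : (((t j : ℤ) : ℚ)) ≠ 0 := by simp
    refine ⟨0, ?_⟩
    rw [Int.cast_zero]
    have h4 : Q i j * (((t j : ℤ) : ℚ) * 2) = 0 := by
      push_cast at h1
      linarith
    simpa [h2] using h4
  have hA2 : Fintype.card V = 2 * f.natDegree := by
    rw [← charpoly_natDegree_eq_dim A, hAf, natDegree_expand, mul_comm]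
  have hB2 : Fintype.card W = 2 * f.natDegree := by
    rw [← charpoly_natDegree_eq_dim B, hBf, natDegree_expand, mul_comm]
  have hdeg : 0 < f.natDegree := by
    have := Fintype.card_pos_iff.2 ⟨i⟩
    omega
  have hself : ∀ u : ℤˣ, ((u : ℤ) : ℤ[X]) * ((u : ℤ) : ℤ[X]) = 1 := fun u => by
    rw [← Int.cast_mul, ← Units.val_mul, Int.units_mul_self]
    simp
  -- the three polynomials involved are odd
  set a := A.charmatrix.adjugate i i with ha
  set b := B.charmatrix.adjugate j j with hb
  set p := ((A.map (Int.castRingHom ℚ)).charmatrix.adjugate * Q.map C) i j with hp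
  have haodd : a.comp (-X) = -a := by
    rw [ha, adjugate_charmatrix_comp_neg_X (s := s) (by simpa using hs) (hA2 ▸ even_two_mul _),
      mul_right_comm, hself, one_mul]
  have hbodd : b.comp (-X) = -b := by
    rw [hb, adjugate_charmatrix_comp_neg_X (s := t) (by simpa using ht) (hB2 ▸ even_two_mul _),
      mul_right_comm, hself, one_mul]
  have hpodd : p.comp (-X) = -p := by
    have hsQ : ∀ k l, ((s k : ℤ) : ℚ) * A.map (Int.castRingHom ℚ) k l =
        -(A.map (Int.castRingHom ℚ) k l * ((s l : ℤ) : ℚ)) := by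
      intro k l
      rw [map_apply, eq_intCast]
      exact_mod_cast hs k l
    rw [hp, mul_apply, ← coe_compRingHom_apply, map_sum, ← Finset.sum_neg_distrib]
    refine Finset.sum_congr rfl fun k _ => ?_
    have h1 : ((s k : ℤ) : ℚ[X]) * C (Q k j) = C (Q k j) * ((t j : ℤ) : ℚ[X]) := by
      simpa using congrArg C (hst k j)
    have h2 : ((t j : ℤ) : ℚ[X]) * ((t j : ℤ) : ℚ[X]) = 1 := by
      rw [← Int.cast_mul, ← Units.val_mul, Int.units_mul_self]
      simp
    rw [map_mul, coe_compRingHom_apply, adjugate_charmatrix_comp_neg_X hsQ (hA2 ▸ even_two_mul _),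
      map_apply, coe_compRingHom_apply, C_comp, neg_mul, mul_assoc, h1, hij]
    linear_combination
      -((A.map (Int.castRingHom ℚ)).charmatrix.adjugate i k * C (Q k j)) * h2
  have hpa := eq_X_mul_expand_two_of_comp_neg_X haodd
  have hpb := eq_X_mul_expand_two_of_comp_neg_X hbodd
  have hpp := eq_X_mul_expand_two_of_comp_neg_X hpodd
  set a' := contract 2 a.divX
  set b' := contract 2 b.divX
  set p' := contract 2 p.divX
  obtain ⟨ι, hι⟩ := pF.exists_algHom_sq pK (by rw [hminF, hminK, map_expand])
  have hιℚ : ∀ g : ℚ[X], aeval pK.gen (expand ℚ 2 g) = ι (aeval pF.gen g) := by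
    intro g
    rw [expand_aeval, ← hι, aeval_algHom_apply]
  have hιℤ : ∀ g : ℤ[X], aeval pK.gen (expand ℤ 2 g) = ι (aeval pF.gen g) := by
    intro g
    rw [← aeval_map_algebraMap ℚ pF.gen, ← hιℚ, ← aeval_map_algebraMap ℚ pK.gen, map_expand]
  have hAQ : (A.map (Int.castRingHom ℚ)).charpoly = minpoly ℚ pK.gen := by
    rw [charpoly_map, hAf, hminK]
  have hirr : Irreducible (minpoly ℚ pK.gen) := minpoly.irreducible pK.isIntegral_gen
  have key := aeval_adjugate_mul_sq (A := A.map (Int.castRingHom ℚ))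
    (B := B.map (Int.castRingHom ℚ))
    (hA.map _) (by rw [charpoly_map, charpoly_map, hAf, hBf]) hQ hAB (hAQ ▸ hirr.separable)
    (μ := pK.gen) (by rw [hAQ, minpoly.aeval]) i j
  have hmapa : (A.map (Int.castRingHom ℚ)).charmatrix.adjugate i i = a.map (algebraMap ℤ ℚ) := by
    rw [charmatrix_map]
    exact (congrFun (congrFun
      (RingHom.map_adjugate (mapRingHom (Int.castRingHom ℚ)) A.charmatrix) i) i).symm
  have hmapb : (B.map (Int.castRingHom ℚ)).charmatrix.adjugate j j = b.map (algebraMap ℤ ℚ) := by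
    rw [charmatrix_map]
    exact (congrFun (congrFun
      (RingHom.map_adjugate (mapRingHom (Int.castRingHom ℚ)) B.charmatrix) j) j).symm
  rw [← hp, hmapa, hmapb, aeval_map_algebraMap, aeval_map_algebraMap, hpa, hpb, hpp, map_mul,
    map_mul, map_mul, aeval_X, aeval_X, hιℚ, hιℤ, hιℤ] at key
  have hgen0 : pK.gen ≠ 0 := by
    intro h0
    have h1 := congrArg natDegree hminK
    rw [h0, minpoly.zero, natDegree_X, (hf.expand two_pos).natDegree_map, natDegree_expand] at h1
    omega
  have hsq' : aeval pF.gen p' ^ 2 = aeval pF.gen (a' * b') := by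
    apply ι.injective
    apply mul_left_cancel₀ (pow_ne_zero 2 hgen0)
    rw [map_pow, map_mul, map_mul]
    linear_combination key
  have hgenF : IsIntegral ℤ pF.gen := ⟨f, hf, by
    have := minpoly.aeval ℚ pF.gen
    rw [hminF] at this
    rwa [show Int.castRingHom ℚ = algebraMap ℤ ℚ from rfl, aeval_map_algebraMap] at this⟩
  have hint : IsIntegral ℤ (aeval pF.gen p') := by
    refine IsIntegral.of_pow two_pos ?_
    rw [hsq']
    exact adjoin_le_integralClosure hgenF (aeval_mem_adjoin_singleton ℤ pF.gen)
  have hcoeff : ∀ k, p'.coeff k = p.coeff (2 * k + 1) := by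
    intro k
    rw [coeff_contract two_ne_zero, coeff_divX, mul_comm]
  -- `p` has degree at most `n - 1`, and its coefficient of `x ^ (n - 1)` is `Q i j`; this is the
  -- coefficient of `x ^ (n / 2 - 1)` in `p'`
  have hpk : ∀ k, Fintype.card V ≤ k → p.coeff k = 0 := by
    intro k hk
    rw [hp, mul_apply, finsetSum_coeff]
    refine Finset.sum_eq_zero fun l _ => ?_
    rw [map_apply, coeff_mul_C, coeff_adjugate_charmatrix_of_card_le _ _ _ hk, zero_mul]
  have htop : p.coeff (Fintype.card V - 1) = Q i j := by
    rw [hp, mul_apply, finsetSum_coeff]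
    simp only [map_apply, coeff_mul_C, coeff_adjugate_charmatrix_card_sub_one]
    simp [one_apply]
  have hdegp : p'.natDegree < f.natDegree := by
    have h1 : p'.natDegree ≤ f.natDegree - 1 :=
      natDegree_le_iff_coeff_eq_zero.2 fun N hN => by rw [hcoeff, hpk _ (by omega)]
    omega
  obtain ⟨z, hz⟩ := pF.exists_int_coeff_of_isIntegral hf hdeg hminF hsq hdegp hint
    (f.natDegree - 1) (by omega)
  refine ⟨z, ?_⟩
  rw [← hz, hcoeff, ← htop]
  congr 1
  omega

end Integrality

/-! ### Bipartitions and permutation matrices -/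

section

variable {V W : Type*} [Fintype V] [DecidableEq V] [Fintype W] [DecidableEq W]

theorem exists_powerBasis_minpoly_eq {g : ℚ[X]} (hg : g.Monic) (hirr : Irreducible g) :
    ∃ (K : Type) (_ : Field K) (_ : Algebra ℚ K) (pb : PowerBasis ℚ K), minpoly ℚ pb.gen = g := by
  have : Fact (Irreducible g) := ⟨hirr⟩
  exact ⟨AdjoinRoot g, inferInstance, inferInstance, AdjoinRoot.powerBasis hg.ne_zero,
    AdjoinRoot.minpoly_powerBasis_gen_of_monic hg⟩

/-- An orthogonal matrix that conjugates the adjacency matrices of two bipartite graphs matches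
the bipartitions. With the diagonal matrices `S`, `S'` of the bipartitions, `Q S' Qᵀ S` commutes
with `A` and is an involution, so it is `1` or `-1`, because the commutant of `A` is a field. -/
theorem Matrix.diagonal_mul_eq_or_eq_neg {A : Matrix V V ℚ} {B : Matrix W W ℚ} {Q : Matrix V W ℚ}
    (hA : A.IsSymm) (hirr : Irreducible A.charpoly) (hQ : Qᵀ * Q = 1) (hQ' : Q * Qᵀ = 1)
    (hAB : A * Q = Q * B) {s : V → ℚ} {t : W → ℚ} (hs2 : ∀ i, s i * s i = 1)
    (ht2 : ∀ i, t i * t i = 1) (hs : diagonal s * A = -(A * diagonal s))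
    (ht : diagonal t * B = -(B * diagonal t)) :
    diagonal s * Q = Q * diagonal t ∨ diagonal s * Q = -(Q * diagonal t) := by
  have hSS : diagonal s * diagonal s = 1 := by
    rw [diagonal_mul_diagonal, ← diagonal_one]
    exact congrArg diagonal (funext hs2)
  have hTT : diagonal t * diagonal t = 1 := by
    rw [diagonal_mul_diagonal, ← diagonal_one]
    exact congrArg diagonal (funext ht2)
  set S := diagonal s with hS
  set T := diagonal t with hT
  have hBA : B * Qᵀ = Qᵀ * A := by
    have h1 := congrArg (fun M => Qᵀ * M * Qᵀ) hAB
    rw [← Matrix.mul_assoc Qᵀ Q B, hQ, Matrix.one_mul, ← Matrix.mul_assoc, Matrix.mul_assoc _ Q Qᵀ,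
      hQ', Matrix.mul_one] at h1
    exact h1.symm
  set Y := Q * T * Qᵀ with hY
  have hYT : Yᵀ = Y := by
    rw [hY, transpose_mul, transpose_mul, transpose_transpose, hT, diagonal_transpose,
      Matrix.mul_assoc]
  have hYY : Y * Y = 1 := by
    calc Y * Y = Q * (T * (Qᵀ * Q) * T) * Qᵀ := by simp only [hY, Matrix.mul_assoc]
      _ = 1 := by rw [hQ, Matrix.mul_one, hTT, Matrix.mul_one, hQ']
  have hYA : A * Y = -(Y * A) := by
    calc A * Y = A * Q * T * Qᵀ := by simp only [hY, Matrix.mul_assoc]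
      _ = -(Q * (T * B) * Qᵀ) := by
        rw [hAB, ht, Matrix.mul_neg, Matrix.neg_mul, neg_neg, Matrix.mul_assoc Q B T]
      _ = -(Y * A) := by
        rw [hY, Matrix.mul_assoc, Matrix.mul_assoc T, hBA]
        simp only [Matrix.mul_assoc]
  have hcomm : Commute A (Y * S) := by
    change A * (Y * S) = Y * S * A
    rw [← Matrix.mul_assoc, hYA, Matrix.mul_assoc Y S A, hs, Matrix.neg_mul, Matrix.mul_neg,
      Matrix.mul_assoc]
  have hsymm : (Y * S)ᵀ = Y * S := by
    obtain ⟨p, hp⟩ := exists_eq_aeval_of_commute hirr hcomm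
    rw [hp]
    exact hA.aeval p
  have hSY : S * Y = Y * S := by
    rw [transpose_mul, hYT, hS, diagonal_transpose] at hsymm
    exact hsymm
  have hsq : Y * S * (Y * S) = 1 := by
    calc Y * S * (Y * S) = Y * (S * Y) * S := by simp only [Matrix.mul_assoc]
      _ = Y * Y * (S * S) := by rw [hSY]; simp only [Matrix.mul_assoc]
      _ = 1 := by rw [hYY, hSS, Matrix.mul_one]
  have hprod : (Y * S - 1) * (Y * S + 1) = 0 := by
    rw [Matrix.sub_mul, Matrix.mul_add, hsq, Matrix.mul_one, Matrix.one_mul]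
    abel
  have hback : Y * S * S * Q = Q * T := by
    rw [Matrix.mul_assoc Y S S, hSS, Matrix.mul_one, hY, Matrix.mul_assoc, hQ, Matrix.mul_one]
  rcases eq_zero_or_eq_zero_of_commute hirr (hcomm.sub_right (Commute.one_right _))
    (hcomm.add_right (Commute.one_right _)) hprod with h | h
  · left
    rw [sub_eq_zero.1 h, Matrix.one_mul] at hback
    exact hback
  · right
    rw [eq_neg_of_add_eq_zero_left h, Matrix.neg_mul, Matrix.one_mul, Matrix.neg_mul] at hback
    rw [← hback, neg_neg]

/-- An integral orthogonal matrix with all row sums `1` is a permutation matrix. -/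
theorem Matrix.exists_equiv_of_orthogonal {Q : Matrix V W ℚ} (hQ : Qᵀ * Q = 1) (hQ' : Q * Qᵀ = 1)
    (h1 : Q *ᵥ 1 = 1) (hint : ∀ i j, ∃ z : ℤ, Q i j = z) :
    ∃ e : W ≃ V, ∀ i j, Q i j = if i = e j then 1 else 0 := by
  have hrow : ∀ i k, ∑ j, Q i j * Q k j = (1 : Matrix V V ℚ) i k := fun i k => by
    rw [← hQ', mul_apply]
    rfl
  have hcol : ∀ j l, ∑ i, Q i j * Q i l = (1 : Matrix W W ℚ) j l := fun j l => by
    rw [← hQ, mul_apply]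
    rfl
  have hsum : ∀ i, ∑ j, Q i j = 1 := fun i => by
    have := congrFun h1 i
    simpa [mulVec, dotProduct] using this
  have h01 : ∀ i j, Q i j = 0 ∨ Q i j = 1 := by
    intro i j
    -- `z ^ 2 - z ≥ 0` for every integer `z`, and these numbers sum to `1 - 1` over a row
    have hz : ∑ j, (Q i j * Q i j - Q i j) = 0 := by
      rw [Finset.sum_sub_distrib, hrow, hsum, one_apply_eq, sub_self]
    have hnn : ∀ j ∈ Finset.univ, 0 ≤ Q i j * Q i j - Q i j := by
      intro j _
      obtain ⟨z, hz⟩ := hint i j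
      rw [hz, sub_nonneg, ← Int.cast_mul, Int.cast_le, ← pow_two]
      exact Int.le_self_sq z
    have h2 := (Finset.sum_eq_zero_iff_of_nonneg hnn).1 hz j (Finset.mem_univ j)
    have h3 : Q i j * (Q i j - 1) = 0 := by linarith
    rcases mul_eq_zero.1 h3 with h | h
    · exact Or.inl h
    · exact Or.inr (by linarith)
  have hnn : ∀ i j, 0 ≤ Q i j := fun i j => by rcases h01 i j with h | h <;> simp [h]
  have hex : ∀ j, ∃ i, Q i j ≠ 0 := by
    intro j
    by_contra! h
    have := hcol j j
    simp [h] at this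
  choose e he using hex
  have huniq : ∀ i j, Q i j ≠ 0 → i = e j := by
    intro i j hij
    by_contra hne
    have h2 := hrow i (e j)
    rw [one_apply_ne hne] at h2
    have h3 := (Finset.sum_eq_zero_iff_of_nonneg fun l _ => mul_nonneg (hnn i l) (hnn (e j) l)).1 h2
      j (Finset.mem_univ j)
    exact (mul_ne_zero hij (he j)) h3
  have hinj : Function.Injective e := by
    intro j l hjl
    by_contra hne
    have h2 := hcol j l
    rw [one_apply_ne hne] at h2
    have h3 := (Finset.sum_eq_zero_iff_of_nonneg fun i _ => mul_nonneg (hnn i j) (hnn i l)).1 h2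
      (e j) (Finset.mem_univ _)
    exact (mul_ne_zero (he j) (hjl ▸ he l)) h3
  have hsurj : Function.Surjective e := by
    intro i
    by_contra! h
    have h2 := hrow i i
    rw [one_apply_eq, Finset.sum_eq_zero] at h2
    · exact zero_ne_one h2
    · intro j _
      have h3 : Q i j = 0 := by
        by_contra hne
        exact h j (huniq i j hne).symm
      rw [h3, zero_mul]
  refine ⟨Equiv.ofBijective e ⟨hinj, hsurj⟩, fun i j => ?_⟩
  change Q i j = if i = e j then 1 else 0
  split_ifs with h
  · rw [h]
    exact (h01 _ _).resolve_left (he j)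
  · by_contra hne
    exact h (huniq i j hne)

theorem SignedGraph.isIsomorphic_of_adjMatrix_eq {V W : Type*} {Γ : SignedGraph V}
    {Γ' : SignedGraph W} (e : W ≃ V)
    (h : ∀ k l, Γ.adjMatrix (e k) (e l) = Γ'.adjMatrix k l) : Γ'.IsIsomorphic Γ := by
  let f : Γ'.graph ≃g Γ.graph :=
    { toEquiv := e
      map_rel_iff' := fun {k l} => by
        rw [← adjMatrix_ne_zero_iff, ← adjMatrix_ne_zero_iff, h] }
  refine ⟨f, ?_⟩
  rintro ⟨x, hx⟩
  induction x using Sym2.ind with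
  | _ k l =>
    have h1 : Γ'.graph.Adj k l := hx
    have h2 : Γ.graph.Adj (e k) (e l) := f.map_rel_iff'.2 h1
    have h3 := h k l
    rw [adjMatrix_of_adj _ h1, adjMatrix_of_adj _ h2] at h3
    exact Units.ext h3

end

/-! ### Signed trees determined by their generalized spectrum -/

section

variable {V : Type*} [Fintype V] [DecidableEq V]

theorem SimpleGraph.charpoly_adjMatrix_map (T : SimpleGraph V) [DecidableRel T.Adj] :
    (T.adjMatrix ℤ).charpoly.map (Int.castRingHom ℚ) = (T.adjMatrix ℚ).charpoly := by
  rw [← charpoly_map]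
  congr 1
  ext i j
  by_cases h : T.Adj i j <;> simp [adjMatrix_apply, h]

/-- A tree with at least two vertices and irreducible characteristic polynomial `φ` has a perfect
matching, `φ = f(x ^ 2)`, and the discriminants satisfy `disc φ = 2 ^ n (disc f) ^ 2`. -/
theorem SimpleGraph.IsTree.exists_charpoly_eq_expand {T : SimpleGraph V} [DecidableRel T.Adj]
    (hT : T.IsTree) (hirr : Irreducible (T.adjMatrix ℚ).charpoly) (hcard : 2 ≤ Fintype.card V) :
    ∃ f : ℤ[X], f.Monic ∧ (T.adjMatrix ℤ).charpoly = expand ℤ 2 f ∧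
      Fintype.card V = 2 * f.natDegree ∧ T.spectralDiscr = 4 ^ f.natDegree * f.discr ^ 2 := by
  set φ := (T.adjMatrix ℤ).charpoly with hφ
  have hφm : φ.Monic := charpoly_monic _
  have hφd : φ.natDegree = Fintype.card V := charpoly_natDegree_eq_dim _
  rw [← charpoly_adjMatrix_map] at hirr
  have h0 : φ.coeff 0 ≠ 0 := by
    intro h0
    have hX : (X : ℚ[X]) ∣ φ.map (Int.castRingHom ℚ) := by
      rw [X_dvd_iff, coeff_map, h0, map_zero]
    have h1 := natDegree_eq_of_degree_eq (degree_eq_degree_of_associated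
      ((irreducible_X.associated_of_dvd hirr hX)))
    rw [natDegree_X, hφm.natDegree_map, hφd] at h1
    omega
  obtain ⟨s, hs⟩ := hT.exists_bipartition
  have hanti : ∀ i j, ((s i : ℤ) : ℤ) * T.adjMatrix ℤ i j =
      -(T.adjMatrix ℤ i j * ((s j : ℤ) : ℤ)) := by
    intro i j
    by_cases h : T.Adj i j
    · rw [hs i j h, Units.val_neg]
      ring
    · simp [adjMatrix_apply, h]
  have hpar := charpoly_comp_neg_X hanti
  have heven : Even (Fintype.card V) := by
    by_contra hodd
    rw [Nat.not_even_iff_odd] at hodd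
    have h1 := congrArg (fun p => p.coeff 0) hpar
    simp only [coeff_comp_neg_X, hodd.neg_one_pow, neg_one_mul, coeff_neg, pow_zero, mul_one] at h1
    exact h0 (by linarith)
  rw [heven.neg_one_pow, one_mul] at hpar
  have hexp := eq_expand_two_of_comp_neg_X hpar
  rw [← hφ] at hexp
  set f := contract 2 φ
  have hfm : f.Monic := (monic_expand_iff two_pos).1 (hexp ▸ hφm)
  have hn : Fintype.card V = 2 * f.natDegree := by
    rw [← hφd, hexp, natDegree_expand, mul_comm]
  refine ⟨f, hfm, hexp, hn, ?_⟩
  have hmap : φ.map (Int.castRingHom ℚ) = expand ℚ 2 (f.map (Int.castRingHom ℚ)) := by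
    rw [← map_expand, ← hexp]
  have hfirr : Irreducible (f.map (Int.castRingHom ℚ)) :=
    of_irreducible_expand two_ne_zero (hmap ▸ hirr)
  obtain ⟨F, _, _, pF, hF⟩ := exists_powerBasis_minpoly_eq (hfm.map _) hfirr
  obtain ⟨K, _, _, pK, hK⟩ := exists_powerBasis_minpoly_eq (hφm.map _) hirr
  have hdisc := pF.discr_expand_two pK hfm (by omega) hF (by rw [hK, ← hexp])
  have hdet : φ.coeff 0 = (-1) ^ f.natDegree := by
    have h1 := det_eq_sign_charpoly_coeff (T.adjMatrix ℤ)
    rw [heven.neg_one_pow, one_mul] at h1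
    rw [← h1, hT.isAcyclic.det_adjMatrix (by rwa [h1]), hn, Nat.mul_div_cancel_left _ two_pos]
  have hdet' : f.coeff 0 = (-1) ^ f.natDegree := by
    rw [← hdet]
    conv_rhs => rw [hexp, coeff_expand two_pos, if_pos (dvd_zero 2), Nat.zero_div]
  rw [spectralDiscr, ← hφ, hexp, hdisc, hdet', ← mul_pow]
  norm_num

theorem two_rpow_neg_mul_sqrt (m : ℕ) (d : ℤ) :
    (2 : ℝ) ^ (-((2 * m : ℕ) : ℝ) / 2) * √((4 ^ m * d ^ 2 : ℤ) : ℝ) = (d.natAbs : ℝ) := by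
  have h1 : -((2 * m : ℕ) : ℝ) / 2 = -(m : ℝ) := by
    push_cast
    ring
  have h2 : ((4 ^ m * d ^ 2 : ℤ) : ℝ) = (2 ^ m * d) ^ 2 := by
    push_cast
    rw [show (4 : ℝ) = 2 ^ 2 by norm_num, mul_pow, ← pow_mul, ← pow_mul, mul_comm 2 m]
  rw [h1, h2, Real.sqrt_sq_eq_abs, abs_mul, abs_of_pos (by positivity), Real.rpow_neg (by norm_num),
    Real.rpow_natCast, inv_mul_cancel_left₀ (by positivity), Nat.cast_natAbs, Int.cast_abs]

/-- A tree whose quantity `2 ^ (-n / 2) √Δ` is an integer has at least two vertices: for a single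
vertex it is `1 / √2`. -/
theorem SimpleGraph.two_le_card_of_rpow_mul_sqrt_eq {T : SimpleGraph V} [DecidableRel T.Adj]
    [Nonempty V] {k : ℕ}
    (hk : (2 : ℝ) ^ (-(Fintype.card V : ℝ) / 2) * √(T.spectralDiscr : ℝ) = k) :
    2 ≤ Fintype.card V := by
  by_contra! h
  have h1 : Fintype.card V = 1 := by
    have := Fintype.card_pos (α := V)
    omega
  have h2 : T.spectralDiscr = 1 := by
    rw [spectralDiscr]
    apply discr_of_degree_eq_one
    rw [charpoly_degree_eq_dim, h1]
    rfl
  rw [h1, h2, Int.cast_one, Real.sqrt_one, mul_one] at hk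
  have h3 : (2 : ℝ) * k ^ 2 = 1 := by
    rw [← hk, ← Real.rpow_natCast, ← Real.rpow_mul (by norm_num)]
    norm_num
  have h4 : 2 * k ^ 2 = 1 := by exact_mod_cast h3
  omega

theorem Matrix.one_dotProduct_map_pow_mulVec_one (A : Matrix V V ℤ) (k : ℕ) :
    (1 : V → ℚ) ⬝ᵥ (A.map (Int.castRingHom ℚ) ^ k *ᵥ 1) = ((∑ i, ∑ j, (A ^ k) i j : ℤ) : ℚ) := by
  rw [← RingHom.mapMatrix_apply, ← map_pow]
  simp [dotProduct, mulVec]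

/-- The cospectral mate is a tree, the orthogonal matrix between the two respects bipartitions once
the second one is oriented suitably, so it is integral, and it is the permutation matrix of an
isomorphism. -/
theorem SignedGraph.isDGS_of_squarefree_discr {Γ : SignedGraph V} (hT : Γ.graph.IsTree) {f : ℤ[X]}
    (hf : f.Monic) (hφ : Γ.adjMatrix.charpoly = expand ℤ 2 f)
    (hirr : Irreducible (Γ.adjMatrix.charpoly.map (Int.castRingHom ℚ)))
    (hsq : Squarefree f.discr) : Γ.IsDGS := by
  intro W _ _ Γ' ⟨hco, hcoc⟩
  set A := Γ.adjMatrix with hA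
  set B := Γ'.adjMatrix with hB
  have hAs : A.IsSymm := Γ.isSymm_adjMatrix
  have hBs : B.IsSymm := Γ'.isSymm_adjMatrix
  have hcard : Fintype.card V = Fintype.card W := by
    rw [← charpoly_natDegree_eq_dim A, ← hco, charpoly_natDegree_eq_dim]
  set A' := A.map (Int.castRingHom ℚ) with hA'
  set B' := B.map (Int.castRingHom ℚ) with hB'
  have hirrA : Irreducible A'.charpoly := by rwa [hA', charpoly_map]
  have hAB : A'.charpoly = B'.charpoly := by rw [hA', hB', charpoly_map, charpoly_map, hco]
  have hirrB : Irreducible B'.charpoly := hAB ▸ hirrA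
  have hwalk := sum_pow_eq hco.symm (sum_adjugate_charmatrix_eq hco.symm hcoc.symm)
  obtain ⟨Q, hQ, hQ', hint, hQ1⟩ := exists_orthogonal_intertwiner (hAs.map _) (hBs.map _) hAB hirrA
    fun k => by rw [one_dotProduct_map_pow_mulVec_one, one_dotProduct_map_pow_mulVec_one, hwalk k]
  -- the cospectral mate is a tree
  have htr : (A * A).trace = (B * B).trace := by
    have h1 : (A' * A').trace = (B' * B').trace := by
      have h2 : B' * B' = Qᵀ * (A' * A' * Q) := by
        rw [Matrix.mul_assoc, hint, ← Matrix.mul_assoc A', hint, Matrix.mul_assoc,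
          ← Matrix.mul_assoc, hQ, Matrix.one_mul]
      rw [h2, trace_mul_comm Qᵀ, Matrix.mul_assoc (A' * A'), hQ', Matrix.mul_one]
    rw [hA', hB', ← Matrix.map_mul, ← Matrix.map_mul] at h1
    have h3 : ∀ {U : Type _} [Fintype U] (M : Matrix U U ℤ),
        (M.map (Int.castRingHom ℚ)).trace = ((M.trace : ℤ) : ℚ) := fun M => by
      simp [trace]
    rw [h3, h3] at h1
    exact_mod_cast h1
  have hT' : Γ'.graph.IsTree := Γ.isTree_of_trace_eq hT hcard hirrB htr
  obtain ⟨s, hs⟩ := Γ.exists_diagonal_anticommute hT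
  obtain ⟨t, ht⟩ := Γ'.exists_diagonal_anticommute hT'
  have hself : ∀ u : ℤˣ, ((u : ℤ) : ℚ) * ((u : ℤ) : ℚ) = 1 := fun u => by
    rw [← Int.cast_mul, ← Units.val_mul, Int.units_mul_self]
    simp
  obtain ⟨t, ht, hst⟩ : ∃ t : W → ℤˣ, (∀ i j, (t i : ℤ) * B i j = -(B i j * t j)) ∧
      ∀ i j, ((s i : ℤ) : ℚ) * Q i j = Q i j * ((t j : ℤ) : ℚ) := by
    have hsA : diagonal (fun i => ((s i : ℤ) : ℚ)) * A' =
        -(A' * diagonal fun i => ((s i : ℤ) : ℚ)) := by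
      ext i j
      rw [Matrix.neg_apply, diagonal_mul, mul_diagonal, hA', map_apply, eq_intCast]
      exact_mod_cast hs i j
    have htB : diagonal (fun i => ((t i : ℤ) : ℚ)) * B' =
        -(B' * diagonal fun i => ((t i : ℤ) : ℚ)) := by
      ext i j
      rw [Matrix.neg_apply, diagonal_mul, mul_diagonal, hB', map_apply, eq_intCast]
      exact_mod_cast ht i j
    rcases diagonal_mul_eq_or_eq_neg (hAs.map _) hirrA hQ hQ' hint (fun i => hself (s i))
      (fun i => hself (t i)) hsA htB with h | h
    · refine ⟨t, ht, fun i j => ?_⟩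
      have := congrFun (congrFun h i) j
      rwa [diagonal_mul, mul_diagonal] at this
    · refine ⟨-t, fun i j => ?_, fun i j => ?_⟩
      · have := ht i j
        simp only [Pi.neg_apply, Units.val_neg]
        linarith
      · have := congrFun (congrFun h i) j
        rw [Matrix.neg_apply, diagonal_mul, mul_diagonal] at this
        rw [this]
        simp
  have hfirr : Irreducible (f.map (Int.castRingHom ℚ)) := by
    rw [hφ, map_expand] at hirr
    exact of_irreducible_expand two_ne_zero hirr
  obtain ⟨F, _, _, pF, hF⟩ := exists_powerBasis_minpoly_eq (hf.map _) hfirr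
  obtain ⟨K, _, _, pK, hK⟩ := exists_powerBasis_minpoly_eq ((charpoly_monic A).map _) hirr
  obtain ⟨e, he⟩ := exists_equiv_of_orthogonal hQ hQ' hQ1
    (exists_int_apply_of_intertwiner hf hφ (hco.trans hφ) hsq pF pK hF (by rw [hK, hφ]) hAs hQ hint
      hs ht hst)
  refine isIsomorphic_of_adjMatrix_eq e fun k l => ?_
  have h1 := congrFun (congrFun hint (e k)) l
  rw [mul_apply, mul_apply] at h1
  simp only [he] at h1
  simpa [hA', hB'] using h1

end

theorem mainTheorem1 {V : Type*} [Fintype V] [DecidableEq V]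
    (T : SimpleGraph V) [DecidableRel T.Adj] (hT : T.IsTree)
    (hirr : Irreducible (T.adjMatrix ℚ).charpoly) :
    -- apart from the one-vertex tree, the quantity `2 ^ (-n/2) * √Δ(T)` is an integer
    (2 ≤ Fintype.card V →
      ∃ k : ℕ, (2 : ℝ) ^ (-(Fintype.card V : ℝ) / 2) * √(T.spectralDiscr : ℝ) = k) ∧
    -- if it is an odd and square-free integer, every signed tree with underlying graph `T` is DGS
    ((∃ k : ℕ, (2 : ℝ) ^ (-(Fintype.card V : ℝ) / 2) * √(T.spectralDiscr : ℝ) = k ∧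
        Odd k ∧ Squarefree k) →
      ∀ σ : T.edgeSet → ℤˣ, (SignedGraph.mk T σ).IsDGS) := by
  constructor
  · intro hcard
    obtain ⟨f, -, -, hn, hdisc⟩ := hT.exists_charpoly_eq_expand hirr hcard
    exact ⟨f.discr.natAbs, by rw [hn, hdisc, two_rpow_neg_mul_sqrt]⟩
  · rintro ⟨k, hk, -, hsq⟩ σ
    have := hT.connected.nonempty
    obtain ⟨f, hf, hexp, hn, hdisc⟩ :=
      hT.exists_charpoly_eq_expand hirr (SimpleGraph.two_le_card_of_rpow_mul_sqrt_eq hk)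
    rw [hn, hdisc, two_rpow_neg_mul_sqrt, Nat.cast_inj] at hk
    rw [← hk, Int.squarefree_natAbs] at hsq
    let Γ := SignedGraph.mk T σ
    have hφ : Γ.adjMatrix.charpoly = (T.adjMatrix ℤ).charpoly := Γ.charpoly_adjMatrix_of_isTree hT
    refine SignedGraph.isDGS_of_squarefree_discr (Γ := Γ) hT hf (hφ.trans hexp) ?_ hsq
    rw [hφ, T.charpoly_adjMatrix_map]
    exact hirr
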